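/- Setting. A synchronous system consists of a finite set $\mathcal V$ of agents joined by a directed graph $G(\mathcal V,\mathcal E)$ without self-loops; $N_i^-=\{j:(j,i)\in\mathcal E\}$ and $d_i^-=|N_i^-|$. Let $f\ge 0$ be an integer. For a set $\mathcal F\subseteq\mathcal V$, a reduced graph is a graph on $\mathcal V\setminus\mathcal F$ obtained from $G$ by deleting $\mathcal F$ with all its edges and then at most $f$ further incoming edges at each remaining agent. Assume that for every $\mathcal F\subseteq\mathcal V$ with $|\mathcal F|\le f$, every reduced graph contains an agent that has a directed path to every other agent of the reduced graph. Fix the set $\mathcal F$ of (Byzantine) faulty agents, $|\mathcal F|\le f$, and put $\mathcal N=\mathcal V\setminus\mathcal F$ and $\phi_i=|N_i^-\cap\mathcal F|$. Let $\mathcal X\subseteq\mathbb R$ be nonempty, closed and convex, with projection $P_{\mathcal X}$, and let $L$ be a constant. Each agent $i$ has an admissible cost function $h_i:\mathcal X\to\mathbb R$: it is convex and continuously differentiable (one-sidedly at end points of $\mathcal X$), $h_i'$ is $L$-Lipschitz, $|h_i'|\le L$ on $\mathcal X$, and $\arg\min_{\mathcal X}h_i$ is nonempty and compact. The stepsizes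 $\lambda[t]$, $t\ge 0$, are real with $\lambda[t+1]\le\lambda[t]$, $\sum_t\lambda[t]=\infty$ and $\sum_t\lambda[t]^2<\infty$. Algorithm 2. Initially $x_j[0]\in\mathcal X$ for each $j\in\mathcal N$. In iteration $t\ge1$, each $j\in\mathcal N$ receives from each $i\in N_j^-$ a pair $(w_i[t-1],g_i[t-1])\in\mathbb R^2$, which equals $(x_i[t-1],h_i'(x_i[t-1]))$ if $i\in\mathcal N$ and is arbitrary (it may depend on $j$ and $t$) if $i\in\mathcal F$; for $i=j$ put $w_j[t-1]=x_j[t-1]$ and $g_j[t-1]=h_j'(x_j[t-1])$. Agent $j$ sorts the values $w_i[t-1]$, $i\in N_j^-$, and erases the $f$ smallest and the $f$ largest ones (ties broken arbitrarily); $\mathcal R_j^1[t-1]$ is the set of the remaining senders. Likewise it erases the $f$ smallest and the $f$ largest of the values $g_i[t-1]$, $i\in N_j^-\cup\{j\}$; let $\hat g_j[t-1]$ and $\check g_j[t-1]$ be the largest and smallest remaining values, and $\widetilde g_j[t-1]=\frac12(\hat g_j[t-1]+\check g_j[t-1])$. Then $$x_j[t]=P_{\mathcal X}\Big[\frac1{d_j^-+1-2f}\sum_{i\in\mathcal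 R_j^1[t-1]\cup\{j\}}w_i[t-1]-\lambda[t-1]\,\widetilde g_j[t-1]\Big].$$ For reals $\beta,\gamma$ let $\mathcal A(\beta,\gamma)$ be the set of functions $p=\sum_{i\in\mathcal N}\alpha_ih_i$ with $\alpha_i\ge0$, $\sum_{i\in\mathcal N}\alpha_i=1$ and $|\{i\in\mathcal N:\alpha_i\ge\beta\}|\ge\gamma$, and let $Y(\beta,\gamma)=\bigcup_{p\in\mathcal A(\beta,\gamma)}\arg\min_{x\in\mathcal X}p(x)$. Theorem. Let $$\tilde\beta=\min\Big\{\frac1{2\max_{i\in\mathcal N}(d_i^-+1-\phi_i-f)},\ \frac1{|\mathcal N|}\Big\},\qquad \tilde\gamma=\min_{i\in\mathcal N}(d_i^-+1-\phi_i-f),$$ and $Y=Y(\tilde\beta,\tilde\gamma)$. For each $t\ge0$ let $z[t]=x_{j_t}[t]$, where $j_t\in\arg\max_{j\in\mathcal N}\mathrm{Dist}(x_j[t],Y)$ and $\mathrm{Dist}(x,Y)=\inf_{y\in Y}|x-y|$. Then, for every execution of Algorithm 2 with faulty set $\mathcal F$, $Y$ is nonempty, the sequence $\mathrm{Dist}(z[t],Y)$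 converges, and $\lim_{t\to\infty}\mathrm{Dist}(z[t],Y)=0$. -/

import Mathlib

open Filter Topology

namespace ByzantineOpt

/-! Directed networks, reduced graphs and source components. -/

section Network

variable {V : Type*} [Fintype V] [DecidableEq V]

open Classical in
/-- The incoming neighbours `N_i⁻` of agent `i`: all `j` with a directed edge from `j` to `i`. -/
noncomputable def inNbrs (G : Digraph V) (i : V) : Finset V :=
  Finset.univ.filter fun j => G.Adj j i

/-- The incoming degree `d_i⁻`. -/
noncomputable def inDeg (G : Digraph V) (i : V) : ℕ := (inNbrs G i).card

open Classical in
/-- `H` is a reduced graph of `G` for the faulty set `F`: a graph on the agents outside `F`,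
obtained from `G` by removing the faulty agents with all their edges and then at most `f` further
incoming edges at each non-faulty agent. (As a relation on `V`, `H` has no edge at an agent of
`F`; its vertex set is `V \ F`.) -/
def IsReducedGraph (G : Digraph V) (F : Finset V) (f : ℕ) (H : Digraph V) : Prop :=
  (∀ u v, H.Adj u v → G.Adj u v ∧ u ∉ F ∧ v ∉ F) ∧
  ∀ i, i ∉ F → ((inNbrs G i).filter fun j => j ∉ F ∧ ¬ H.Adj j i).card ≤ f

/-- The source component of a graph `H` with vertex set `V \ F`: the agents that have a directed
path to every other agent. -/
def sourceComponent (F : Finset V) (H : Digraph V) : Set V :=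
  {i | i ∉ F ∧ ∀ j, j ∉ F → Relation.ReflTransGen H.Adj i j}

/-- For every set of at most `f` agents that could be faulty, every reduced graph contains a
(nonempty) source component. -/
def EveryReducedGraphHasSource (G : Digraph V) (f : ℕ) : Prop :=
  ∀ F : Finset V, F.card ≤ f →
    ∀ H : Digraph V, IsReducedGraph G F f H → (sourceComponent F H).Nonempty

/-- Under the graph condition there is a non-faulty agent. -/
theorem EveryReducedGraphHasSource.nonempty {G : Digraph V} {f : ℕ}
    (hG : EveryReducedGraphHasSource G f) {F : Finset V} (hF : F.card ≤ f) : Fᶜ.Nonempty := by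
  classical
  have hred : IsReducedGraph G F f ⟨fun u v => G.Adj u v ∧ u ∉ F ∧ v ∉ F⟩ := by
    refine ⟨fun u v h => h, fun i hi => ?_⟩
    refine (Finset.card_eq_zero.2 (Finset.eq_empty_of_forall_notMem fun j hj => ?_)).trans_le
      (Nat.zero_le f)
    simp only [inNbrs, Finset.mem_filter, Finset.mem_univ, true_and] at hj
    tauto
  obtain ⟨i, hi, -⟩ := hG F hF _ hred
  exact ⟨i, by simpa using hi⟩

/-- The number `d_i⁻ + 1 - φ_i - f`, where `φ_i` counts the faulty incoming neighbours of `i`. -/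
noncomputable def slack (G : Digraph V) (F : Finset V) (f : ℕ) (i : V) : ℝ :=
  (inDeg G i : ℝ) + 1 - ((inNbrs G i ∩ F).card : ℝ) - (f : ℝ)

/-- `β̃ = min {1 / (2 max_{i ∈ N} (d_i⁻ + 1 - φ_i - f)), 1 / |N|}`, where `N = V \ F`. -/
noncomputable def betaTilde (G : Digraph V) (F : Finset V) (f : ℕ) (hN : Fᶜ.Nonempty) : ℝ :=
  min (1 / (2 * Fᶜ.sup' hN (slack G F f))) (1 / (Fᶜ.card : ℝ))

/-- `γ̃ = min_{i ∈ N} (d_i⁻ + 1 - φ_i - f)`, where `N = V \ F`. -/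
noncomputable def gammaTilde (G : Digraph V) (F : Finset V) (f : ℕ) (hN : Fᶜ.Nonempty) : ℝ :=
  Fᶜ.inf' hN (slack G F f)

end Network

/-! Cost functions, valid functions and the set of their constrained optima. -/

/-- The minimizers of `p` over `X`. -/
def argminOn (p : ℝ → ℝ) (X : Set ℝ) : Set ℝ := {x | x ∈ X ∧ IsMinOn p X x}

/-- `h` is an admissible cost function on `X` with constant `L`. Only the values of `h` on `X`
matter; the gradient is the derivative within `X` (one-sided at an end point of `X`). -/
structure Admissible (X : Set ℝ) (L : ℝ) (h : ℝ → ℝ) : Prop where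
  convex : ConvexOn ℝ X h
  contDiff : ContDiffOn ℝ 1 h X
  lipschitz_grad : ∀ x ∈ X, ∀ y ∈ X, |derivWithin h X x - derivWithin h X y| ≤ L * |x - y|
  bounded_grad : ∀ x ∈ X, |derivWithin h X x| ≤ L
  argmin_nonempty : (argminOn h X).Nonempty
  argmin_compact : IsCompact (argminOn h X)

section Valid

variable {V : Type*} [Fintype V] [DecidableEq V]

open Classical in
/-- The collection `A(β, γ)` of valid functions: convex combinations of the cost functions of the
agents outside `F`, at least `γ` of which have a weight that is at least `β`. -/
def validFunctions (F : Finset V) (h : V → ℝ → ℝ) (β γ : ℝ) : Set (ℝ → ℝ) :=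
  {p | ∃ α : V → ℝ, (∀ i ∈ Fᶜ, 0 ≤ α i) ∧ ∑ i ∈ Fᶜ, α i = 1 ∧
    γ ≤ ((Fᶜ.filter fun i => β ≤ α i).card : ℝ) ∧ p = fun x => ∑ i ∈ Fᶜ, α i * h i x}

/-- `Y(β, γ)`: the minimizers over `X` of the valid functions. -/
def optSet (X : Set ℝ) (F : Finset V) (h : V → ℝ → ℝ) (β γ : ℝ) : Set ℝ :=
  ⋃ p ∈ validFunctions F h β γ, argminOn p X

end Valid

/-! The algorithm. -/

/-- `y` is the projection of `u` on `X`. -/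
def IsProjection (X : Set ℝ) (u y : ℝ) : Prop := y ∈ X ∧ ∀ z ∈ X, |y - u| ≤ |z - u|

section Algorithm

variable {V : Type*} [Fintype V] [DecidableEq V]

/-- `R` is what remains of the set `A` of identifiers when the values `v i`, `i ∈ A`, are sorted
(ties broken arbitrarily) and the `f` smallest (from `S`) and the `f` largest ones (from `T`) are
erased. -/
def IsTrimmed (A : Finset V) (v : V → ℝ) (f : ℕ) (R : Finset V) : Prop :=
  ∃ S T : Finset V, S ⊆ A ∧ T ⊆ A ∧ Disjoint S T ∧ S.card = f ∧ T.card = f ∧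
    (∀ s ∈ S, ∀ k ∈ A \ S, v s ≤ v k) ∧ (∀ l ∈ T, ∀ k ∈ A \ T, v k ≤ v l) ∧
    R = A \ (S ∪ T)

/-- One iteration of Algorithm 2 at agent `j`, for the previous estimates `x` and the stepsize
`lam`, resulting in the new estimate `y`. Here `(w i, g i)` is the tuple that `j` receives from
`i` (for `i = j`, its own estimate and gradient). What a faulty neighbour `i ∈ F` sends to `j`, or
the default tuple if nothing is sent, is arbitrary. -/
def AlgorithmStep (G : Digraph V) (F : Finset V) (f : ℕ) (X : Set ℝ) (h : V → ℝ → ℝ)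
    (lam : ℝ) (x : V → ℝ) (j : V) (y : ℝ) : Prop :=
  ∃ w g : V → ℝ,
    (∀ i ∈ insert j (inNbrs G j), i ∉ F → w i = x i ∧ g i = derivWithin (h i) X (x i)) ∧
    ∃ R₁ R₂ : Finset V,
      IsTrimmed (inNbrs G j) w f R₁ ∧
      IsTrimmed (insert j (inNbrs G j)) g f R₂ ∧
      ∃ gmax gmin : ℝ,
        IsGreatest (g '' (R₂ : Set V)) gmax ∧ IsLeast (g '' (R₂ : Set V)) gmin ∧
        IsProjection X
          (1 / ((inDeg G j : ℝ) + 1 - 2 * (f : ℝ)) * (∑ i ∈ insert j R₁, w i)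
            - lam * ((gmax + gmin) / 2)) y

/-- `x t j` is the estimate of agent `j` after `t` iterations of an execution of Algorithm 2 with
faulty set `F`. The values at the faulty agents are irrelevant. -/
def IsExecution (G : Digraph V) (F : Finset V) (f : ℕ) (X : Set ℝ) (h : V → ℝ → ℝ)
    (lam : ℕ → ℝ) (x : ℕ → V → ℝ) : Prop :=
  (∀ j, j ∉ F → x 0 j ∈ X) ∧
  ∀ t, ∀ j, j ∉ F → AlgorithmStep G F f X h (lam t) (x t) j (x (t + 1) j)

end Algorithm

/-- The stepsizes are non-increasing, not summable, and square-summable. -/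
structure IsStepsize (lam : ℕ → ℝ) : Prop where
  antitone : Antitone lam
  sum_infinite : Tendsto (fun n => ∑ t ∈ Finset.range n, lam t) atTop atTop
  sum_sq_finite : Summable fun t => lam t ^ 2

end ByzantineOpt

/-! Trimming has two effects. A surviving value lies between two non-faulty values, so the trimmed
mean of estimates stays in the hull of the non-faulty estimates. And the midpoint of the surviving
gradients is a convex combination of non-faulty gradients with valid weights
(`IsTrimmed.exists_weights`): at least `γ̃` of them are at least `β̃`. Hence every update is a
projected gradient step, with a valid gradient, from a point of that hull
(`IsExecution.isProjectedGradient`).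

Consensus: the graph condition forces one of any two disjoint nonempty non-faulty groups to listen
to more than `f` non-faulty agents outside itself (`EveryReducedGraphHasSource.exists_card_lt`).
Applied to the agents near the maximum and those near the minimum, this contracts the diameter over
every `|Fᶜ|` steps, up to an error of order `lam t * L`, so the diameter tends to 0.

Descent: suppose `b = sup Y` is finite and the largest estimate is well above `b`. By consensus all
estimates then exceed some fixed `x₀ > b`. Every valid gradient at `x₀` is positive, and by
compactness of the weights at least some `δ > 0`; monotonicity of derivatives carries this bound to
the actual estimates. The maximum thus drops by `δ * lam t`, and divergence of the stepsize sum
brings it close to `b`; later rises are at most `lam t * L`, which tends to 0. The minimum is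
treated in the same way. Finally `Y` is an interval (`optSet_ordConnected`), so being nearly below
one point of `Y` and nearly above another means being near `Y`. -/

namespace ByzantineOpt

/-! ### Trimmed values and trimmed gradients -/

section Trimming

variable {V : Type*} [DecidableEq V]

theorem IsTrimmed.neg {A R : Finset V} {v : V → ℝ} {f : ℕ} (hR : IsTrimmed A v f R) :
    IsTrimmed A (fun i => -v i) f R := by
  obtain ⟨S, T, hS, hT, hd, hSc, hTc, hSv, hTv, rfl⟩ := hR
  refine ⟨T, S, hT, hS, hd.symm, hTc, hSc, fun s hs k hk => neg_le_neg (hTv s hs k hk),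
    fun s hs k hk => neg_le_neg (hSv s hs k hk), by rw [Finset.union_comm]⟩

theorem IsTrimmed.subset {A R : Finset V} {v : V → ℝ} {f : ℕ} (hR : IsTrimmed A v f R) :
    R ⊆ A := by
  obtain ⟨S, T, -, -, -, -, -, -, -, rfl⟩ := hR
  exact Finset.sdiff_subset

theorem IsTrimmed.card_add {A R : Finset V} {v : V → ℝ} {f : ℕ} (hR : IsTrimmed A v f R) :
    R.card + 2 * f = A.card := by
  obtain ⟨S, T, hS, hT, hd, hSc, hTc, -, -, rfl⟩ := hR
  have h1 := Finset.card_sdiff_add_card_eq_card (Finset.union_subset hS hT)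
  rw [Finset.card_union_of_disjoint hd] at h1
  omega

/-- A value that survives trimming is dominated by the value of a non-faulty agent. -/
theorem IsTrimmed.exists_le {A R F : Finset V} {v : V → ℝ} {f : ℕ} (hF : F.card ≤ f)
    (hR : IsTrimmed A v f R) {r : V} (hr : r ∈ R) : ∃ u ∈ A \ F, v r ≤ v u := by
  obtain ⟨S, T, hS, hT, hd, hSc, hTc, hSv, hTv, rfl⟩ := hR
  simp only [Finset.mem_sdiff, Finset.mem_union, not_or] at hr
  -- `r` together with the `f` erased largest values makes `f + 1` agents with value at least `v r`;
  -- they cannot all be faulty.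
  have hcard : F.card < (insert r T).card := by
    rw [Finset.card_insert_of_notMem hr.2.2]; omega
  obtain ⟨u, hu, huF⟩ := Finset.exists_mem_notMem_of_card_lt_card hcard
  rcases Finset.mem_insert.1 hu with rfl | hu
  · exact ⟨u, Finset.mem_sdiff.2 ⟨hr.1, huF⟩, le_rfl⟩
  · exact ⟨u, Finset.mem_sdiff.2 ⟨hT hu, huF⟩,
      hTv u hu r (Finset.mem_sdiff.2 ⟨hr.1, hr.2.2⟩)⟩

theorem IsTrimmed.exists_ge {A R F : Finset V} {v : V → ℝ} {f : ℕ} (hF : F.card ≤ f)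
    (hR : IsTrimmed A v f R) {r : V} (hr : r ∈ R) : ∃ u ∈ A \ F, v u ≤ v r := by
  obtain ⟨u, hu, h⟩ := hR.neg.exists_le hF hr
  exact ⟨u, hu, neg_le_neg_iff.1 h⟩

/-- If more than `f` of the values are at most `c` and something survives, then some surviving
value is at most `c`. -/
theorem IsTrimmed.exists_mem_le {A R D : Finset V} {v : V → ℝ} {f : ℕ} (hR : IsTrimmed A v f R)
    (hne : R.Nonempty) (hDA : D ⊆ A) (hD : f < D.card) {c : ℝ} (hc : ∀ i ∈ D, v i ≤ c) :
    ∃ r ∈ R, v r ≤ c := by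
  obtain ⟨S, T, hS, hT, hd, hSc, hTc, hSv, hTv, rfl⟩ := hR
  -- Not all of `D` is erased at the bottom. If `k` is erased at the top instead, every survivor is
  -- at most `v k`.
  obtain ⟨k, hk, hkS⟩ := Finset.exists_mem_notMem_of_card_lt_card (hSc.trans_lt hD)
  by_cases hkT : k ∈ T
  · obtain ⟨r, hr⟩ := hne
    refine ⟨r, hr, (hTv k hkT r ?_).trans (hc k hk)⟩
    simp only [Finset.mem_sdiff, Finset.mem_union, not_or] at hr ⊢
    exact ⟨hr.1, hr.2.2⟩
  · exact ⟨k, by simp [hDA hk, hkS, hkT], hc k hk⟩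

/-- The endpoint nearer to `c` carries at least half of the weight. -/
theorem exists_weight_of_between {a b c : ℝ} (hac : a ≤ c) (hcb : c ≤ b) (h : c - a ≤ b - c) :
    ∃ θ : ℝ, 1 / 2 ≤ θ ∧ θ ≤ 1 ∧ θ * a + (1 - θ) * b = c := by
  rcases eq_or_lt_of_le (hac.trans hcb) with hab | hab
  · exact ⟨1, by norm_num, le_rfl, by linarith⟩
  · have h0 : 0 < b - a := by linarith
    refine ⟨(b - c) / (b - a), ?_, ?_, ?_⟩
    · rw [div_le_div_iff₀ (by norm_num) h0]; linarith
    · rw [div_le_one h0]; linarith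
    · field_simp; ring

theorem exists_weight_of_between' {a b c : ℝ} (hca : c ≤ a) (hbc : b ≤ c) (h : a - c ≤ c - b) :
    ∃ θ : ℝ, 1 / 2 ≤ θ ∧ θ ≤ 1 ∧ θ * a + (1 - θ) * b = c := by
  obtain ⟨θ, h1, h2, h3⟩ := exists_weight_of_between (neg_le_neg hca) (neg_le_neg hbc)
    (by linarith)
  exact ⟨θ, h1, h2, by linarith⟩

/-- An average over `Q` of convex combinations with weight at least `1/2` at `q ∈ Q` is a convex
combination with weight at least `1/(2|Q|)` at every `q ∈ Q`. -/
theorem exists_weights_of_forall {B Q : Finset V} (hQB : Q ⊆ B) (hQ : Q.Nonempty) {g : V → ℝ}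
    {c : ℝ} (hgood : ∀ q ∈ Q, ∃ u ∈ B, ∃ θ : ℝ, 1 / 2 ≤ θ ∧ θ ≤ 1 ∧
      θ * g q + (1 - θ) * g u = c) :
    ∃ α : V → ℝ, (∀ i, 0 ≤ α i) ∧ (∀ i, i ∉ B → α i = 0) ∧ ∑ i ∈ B, α i = 1 ∧
      (∀ q ∈ Q, 1 / (2 * (Q.card : ℝ)) ≤ α q) ∧ ∑ i ∈ B, α i * g i = c := by
  choose! u hu θ hθ1 hθ2 hθ using hgood
  have hm : (0 : ℝ) < Q.card := by exact_mod_cast hQ.card_pos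
  -- `κ q` is the two-point distribution on `q` and `u q` with mean `c`; the weights sought are the
  -- average of the `κ q` over `Q`.
  let κ : V → V → ℝ := fun q i => θ q * (if i = q then 1 else 0) +
    (1 - θ q) * (if i = u q then 1 else 0)
  have hκ0 : ∀ q ∈ Q, ∀ i, 0 ≤ κ q i := by
    intro q hq i
    have h1 := hθ1 q hq
    have h2 := hθ2 q hq
    refine add_nonneg (mul_nonneg (by linarith) ?_) (mul_nonneg (by linarith) ?_) <;>
      split_ifs <;> norm_num
  have hκsum : ∀ q ∈ Q, ∀ a : V → ℝ, ∑ i ∈ B, κ q i * a i = θ q * a q + (1 - θ q) * a (u q) := by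
    intro q hq a
    simp only [κ, add_mul, Finset.sum_add_distrib, mul_assoc, ← Finset.mul_sum, ite_mul, one_mul,
      zero_mul, Finset.sum_ite_eq', hQB hq, hu q hq, if_true]
  have hsum : ∀ a : V → ℝ, ∑ i ∈ B, ((∑ q ∈ Q, κ q i) / Q.card) * a i =
      (∑ q ∈ Q, (θ q * a q + (1 - θ q) * a (u q))) / Q.card := by
    intro a
    rw [← Finset.sum_congr rfl fun q hq => hκsum q hq a, Finset.sum_comm, Finset.sum_div]
    refine Finset.sum_congr rfl fun i _ => ?_
    rw [← Finset.sum_mul]; ring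
  refine ⟨fun i => (∑ q ∈ Q, κ q i) / Q.card, fun i => ?_, fun i hi => ?_, ?_, fun q hq => ?_, ?_⟩
  · exact div_nonneg (Finset.sum_nonneg fun q hq => hκ0 q hq i) hm.le
  · refine div_eq_zero_iff.2 (Or.inl (Finset.sum_eq_zero fun q hq => ?_))
    have h1 : i ≠ q := fun h => hi (h ▸ hQB hq)
    have h2 : i ≠ u q := fun h => hi (h ▸ hu q hq)
    simp [κ, h1, h2]
  · have h1 := hsum fun _ => 1
    simp only [mul_one] at h1
    rw [h1, Finset.sum_congr rfl fun q _ => add_sub_cancel (θ q) 1]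
    simp [hm.ne']
  · have h1 : 1 / 2 ≤ κ q q := by
      have h2 : θ q ≤ κ q q := by
        have := hθ2 q hq
        simp only [κ, if_true, mul_one, le_add_iff_nonneg_right]
        exact mul_nonneg (by linarith) (by split_ifs <;> norm_num)
      exact (hθ1 q hq).trans h2
    rw [← div_div]
    exact div_le_div_of_nonneg_right
      (h1.trans (Finset.single_le_sum (f := fun q' => κ q' q) (fun q' hq' => hκ0 q' hq' q) hq))
      hm.le
  · rw [hsum g, Finset.sum_congr rfl hθ]
    simp [hm.ne']

/-- The midpoint of the trimmed gradient range is a convex combination of the non-faulty values in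
which at least `|A \ F| - f` weights are bounded below. -/
theorem IsTrimmed.exists_weights {A R F : Finset V} {g : V → ℝ} {f m : ℕ} (hF : F.card ≤ f)
    (hR : IsTrimmed A g f R) {gmax gmin : ℝ} (hmax : IsGreatest (g '' (R : Set V)) gmax)
    (hmin : IsLeast (g '' (R : Set V)) gmin) (hm : m + f = (A \ F).card) (hm0 : 0 < m) :
    ∃ α : V → ℝ, (∀ i, 0 ≤ α i) ∧ (∀ i, i ∉ A \ F → α i = 0) ∧ ∑ i ∈ A \ F, α i = 1 ∧
      (∃ Q ⊆ A \ F, Q.card = m ∧ ∀ q ∈ Q, 1 / (2 * (m : ℝ)) ≤ α q) ∧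
      ∑ i ∈ A \ F, α i * g i = (gmax + gmin) / 2 := by
  classical
  set c := (gmax + gmin) / 2 with hc
  -- `q` is good when some non-faulty value lies across `c`, at least as far from `c` as `g q`. It
  -- suffices that at most `f` non-faulty agents fail to be good.
  let good : V → Prop := fun q => ∃ u ∈ A \ F, ∃ θ : ℝ, 1 / 2 ≤ θ ∧ θ ≤ 1 ∧
      θ * g q + (1 - θ) * g u = c
  suffices hgood : ∃ E : Finset V, E.card ≤ f ∧ ∀ q ∈ (A \ F) \ E, good q by
    obtain ⟨E, hE, hgood⟩ := hgood
    have h1 := Finset.le_card_sdiff E (A \ F)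
    obtain ⟨Q, hQ, hQc⟩ := Finset.exists_subset_card_eq (show m ≤ ((A \ F) \ E).card by omega)
    have hQne : Q.Nonempty := Finset.card_pos.1 (by omega)
    obtain ⟨α, h0, hsupp, hs, hQα, hg⟩ := exists_weights_of_forall
      (hQ.trans Finset.sdiff_subset) hQne (g := g) (c := c) fun q hq => hgood q (hQ hq)
    exact ⟨α, h0, hsupp, hs, ⟨Q, hQ.trans Finset.sdiff_subset, hQc, hQc ▸ hQα⟩, hg⟩
  obtain ⟨rM, hrM, hrMe⟩ := hmax.1
  obtain ⟨rm, hrm, hrme⟩ := hmin.1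
  obtain ⟨u, hu, hgu⟩ := hR.exists_le hF hrM
  obtain ⟨l, hl, hgl⟩ := hR.exists_ge hF hrm
  have hle : gmin ≤ gmax := hmax.2 hmin.1
  -- A survivor is within `(gmax - gmin) / 2` of `c`, and `u` and `l` lie at least that far out on
  -- the two sides.
  have hRgood : ∀ q ∈ R, good q := by
    intro q hq
    have h1 : g q ≤ gmax := hmax.2 ⟨q, hq, rfl⟩
    have h2 : gmin ≤ g q := hmin.2 ⟨q, hq, rfl⟩
    rcases le_total (g q) c with h | h
    · exact ⟨u, hu, exists_weight_of_between h (by linarith) (by linarith)⟩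
    · exact ⟨l, hl, exists_weight_of_between' h (by linarith) (by linarith)⟩
  obtain ⟨S, T, hS, hT, hd, hSc, hTc, hSv, hTv, rfl⟩ := hR
  have hgS : ∀ s ∈ S, g s ≤ gmin := by
    intro s hs
    rw [← hrme]
    simp only [Finset.coe_sdiff, Finset.coe_union, Set.mem_sdiff, Set.mem_union, Finset.mem_coe,
      not_or] at hrm
    exact hSv s hs rm (Finset.mem_sdiff.2 ⟨hrm.1, hrm.2.1⟩)
  have hgT : ∀ s ∈ T, gmax ≤ g s := by
    intro s hs
    rw [← hrMe]
    simp only [Finset.coe_sdiff, Finset.coe_union, Set.mem_sdiff, Set.mem_union, Finset.mem_coe,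
      not_or] at hrM
    exact hTv s hs rM (Finset.mem_sdiff.2 ⟨hrM.1, hrM.2.2⟩)
  -- One of the two erased sets contains only good non-faulty agents: if some `s ∈ S` is bad, no
  -- value in `T \ F` is as far from `c` as `g s`, so `s` itself witnesses that all of `T \ F` is
  -- good.
  by_cases hall : ∀ s ∈ S \ F, good s
  · refine ⟨T, hTc.le, fun q hq => ?_⟩
    simp only [Finset.mem_sdiff] at hq
    by_cases hqS : q ∈ S
    · exact hall q (Finset.mem_sdiff.2 ⟨hqS, hq.1.2⟩)
    · exact hRgood q (by simp [hq, hqS])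
  · push Not at hall
    obtain ⟨s, hs, hsbad⟩ := hall
    refine ⟨S, hSc.le, fun q hq => ?_⟩
    simp only [Finset.mem_sdiff] at hq hs
    by_cases hqT : q ∈ T
    · have h1 := hgT q hqT
      have h2 := hgS s hs.1
      have hsA : s ∈ A \ F := Finset.mem_sdiff.2 ⟨hS hs.1, hs.2⟩
      rcases le_total (c - g s) (g q - c) with h | h
      · exact absurd ⟨q, Finset.mem_sdiff.2 hq.1,
          exists_weight_of_between (by linarith) (by linarith) h⟩ hsbad
      · exact ⟨s, hsA, exists_weight_of_between' (by linarith) (by linarith) h⟩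
    · exact hRgood q (by simp [hq, hqT])

end Trimming

/-! ### Projection onto an interval -/

/-- Otherwise `max u v` would lie between two points of `X`, hence in `X`, and be closer to `u` than
`y` is. -/
theorem IsProjection.le_max {X : Set ℝ} (hX : X.OrdConnected) {u y v : ℝ}
    (hy : IsProjection X u y) (hv : v ∈ X) : y ≤ max u v := by
  by_contra! hlt
  have hmem : max u v ∈ X := hX.out hv hy.1 ⟨le_max_right _ _, hlt.le⟩
  have h1 := hy.2 _ hmem
  have h2 := le_max_left u v
  rw [abs_of_nonneg (by linarith), abs_of_nonneg (by linarith)] at h1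
  linarith

theorem IsProjection.min_le {X : Set ℝ} (hX : X.OrdConnected) {u y v : ℝ}
    (hy : IsProjection X u y) (hv : v ∈ X) : min u v ≤ y := by
  by_contra! hlt
  have hmem : min u v ∈ X := hX.out hy.1 hv ⟨hlt.le, min_le_right _ _⟩
  have h1 := hy.2 _ hmem
  have h2 := min_le_left u v
  rw [abs_of_nonpos (by linarith), abs_of_nonpos (by linarith)] at h1
  linarith

/-! ### Consequences of the graph condition -/

section Network

variable {V : Type*} [Fintype V] [DecidableEq V]

open Classical in
/-- Of two disjoint nonempty sets of non-faulty agents, one has a member with more than `f`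
non-faulty incoming neighbours outside of that set. -/
theorem EveryReducedGraphHasSource.exists_card_lt {G : Digraph V} {f : ℕ}
    (hG : EveryReducedGraphHasSource G f) {F : Finset V} (hF : F.card ≤ f) {A B : Finset V}
    (hA : A.Nonempty) (hB : B.Nonempty) (hAB : Disjoint A B) (hAF : Disjoint A F)
    (hBF : Disjoint B F) :
    (∃ i ∈ A, f < ((inNbrs G i \ F) \ A).card) ∨ (∃ i ∈ B, f < ((inNbrs G i \ F) \ B).card) := by
  by_contra! hcon
  obtain ⟨hcA, hcB⟩ := hcon
  -- Cut all edges entering `A` or `B` from outside. If the claim fails this is a reduced graph, and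
  -- following paths backwards puts its source in both `A` and `B`.
  let H : Digraph V := ⟨fun u v => (G.Adj u v ∧ u ∉ F ∧ v ∉ F) ∧ (v ∈ A → u ∈ A) ∧
    (v ∈ B → u ∈ B)⟩
  have hH : IsReducedGraph G F f H := by
    refine ⟨fun u v huv => huv.1, fun i hi => ?_⟩
    by_cases hiA : i ∈ A
    · have hiB : i ∉ B := Finset.disjoint_left.1 hAB hiA
      refine (Finset.card_le_card fun u hu => ?_).trans (hcA i hiA)
      simp only [inNbrs, Finset.mem_filter, Finset.mem_univ, true_and, Finset.mem_sdiff, H] at hu ⊢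
      tauto
    · by_cases hiB : i ∈ B
      · refine (Finset.card_le_card fun u hu => ?_).trans (hcB i hiB)
        simp only [inNbrs, Finset.mem_filter, Finset.mem_univ, true_and, Finset.mem_sdiff, H]
          at hu ⊢
        tauto
      · refine (Finset.card_eq_zero.2 (Finset.eq_empty_of_forall_notMem fun u hu => ?_)).trans_le
          (Nat.zero_le f)
        simp only [inNbrs, Finset.mem_filter, Finset.mem_univ, true_and, H] at hu
        tauto
  obtain ⟨s, hsF, hs⟩ := hG F hF H hH
  have hback : ∀ C : Finset V, (∀ u v, H.Adj u v → v ∈ C → u ∈ C) → ∀ a ∈ C, a ∉ F → s ∈ C := by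
    intro C hC a ha haF
    have hsa := hs a haF
    clear hs hsF
    induction hsa using Relation.ReflTransGen.head_induction_on with
    | refl => exact ha
    | head h1 _ ih => exact hC _ _ h1 ih
  obtain ⟨a, ha⟩ := hA
  obtain ⟨b, hb⟩ := hB
  exact Finset.disjoint_left.1 hAB
    (hback A (fun u v h => h.2.1) a ha (Finset.disjoint_left.1 hAF ha))
    (hback B (fun u v h => h.2.2) b hb (Finset.disjoint_left.1 hBF hb))

/-- Guarantees that an estimate survives trimming when `f > 0`. Were the degree exactly `2 * f`,
declare half of the neighbours faulty: `j` then has only `f` other neighbours, and each remaining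
agent can hear at most `j` from outside the complement of `{j}`, contradicting `exists_card_lt`. -/
theorem EveryReducedGraphHasSource.two_mul_lt_inDeg {G : Digraph V} (hloop : ∀ i, ¬ G.Adj i i)
    {f : ℕ} (hG : EveryReducedGraphHasSource G f) (hf : 0 < f) {j : V}
    (hj : 2 * f ≤ inDeg G j) : 2 * f < inDeg G j := by
  by_contra! hle
  have hdeg : (inNbrs G j).card = 2 * f := le_antisymm hle hj
  obtain ⟨F, hFs, hFc⟩ := Finset.exists_subset_card_eq (show f ≤ (inNbrs G j).card by omega)
  have hjn : j ∉ inNbrs G j := by simp [inNbrs, hloop]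
  have hjF : j ∉ F := fun h => hjn (hFs h)
  have hW : (inNbrs G j \ F).card = f := by
    have := Finset.card_sdiff_add_card_eq_card hFs
    omega
  obtain ⟨w, hw⟩ : (inNbrs G j \ F).Nonempty := Finset.card_pos.1 (by omega)
  rw [Finset.mem_sdiff] at hw
  have hwj : w ≠ j := fun h => hjn (h ▸ hw.1)
  rcases hG.exists_card_lt hFc.le (A := {j}) (B := (insert j F)ᶜ) (Finset.singleton_nonempty j)
    ⟨w, by simp [hwj, hw.2]⟩ (by simp) (by simpa using hjF)
    (Finset.disjoint_left.2 fun a ha haF => by simp [haF] at ha) with ⟨i, hi, hlt⟩ | ⟨i, hi, hlt⟩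
  · rw [Finset.mem_singleton] at hi
    subst hi
    have := Finset.card_le_card (Finset.sdiff_subset : (inNbrs G i \ F) \ {i} ⊆ _)
    omega
  · have h1 : (inNbrs G i \ F) \ (insert j F)ᶜ ⊆ {j} := by
      intro a ha
      simp only [Finset.mem_sdiff, Finset.mem_compl, Finset.mem_insert, not_not] at ha
      simp; tauto
    have := Finset.card_le_card h1
    rw [Finset.card_singleton] at this
    omega

end Network

/-! ### Tangent inequality and monotone derivatives -/

theorem Admissible.differentiableOn {X : Set ℝ} {L : ℝ} {h : ℝ → ℝ} (hh : Admissible X L h) :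
    DifferentiableOn ℝ h X :=
  hh.contDiff.differentiableOn one_ne_zero

theorem Admissible.add_derivWithin_mul_le {X : Set ℝ} {L : ℝ} {h : ℝ → ℝ} (hh : Admissible X L h)
    {x y : ℝ} (hx : x ∈ X) (hy : y ∈ X) : h x + derivWithin h X x * (y - x) ≤ h y := by
  rcases lt_trichotomy x y with hxy | rfl | hxy
  · have h1 := hh.convex.derivWithin_le_slope hx hy hxy (hh.differentiableOn x hx)
    rw [slope_def_field, le_div_iff₀ (by linarith)] at h1
    linarith
  · simp
  · have h1 := hh.convex.slope_le_derivWithin hy hx hxy (hh.differentiableOn x hx)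
    rw [slope_def_field, div_le_iff₀ (by linarith)] at h1
    linarith

theorem Admissible.derivWithin_mono {X : Set ℝ} {L : ℝ} {h : ℝ → ℝ} (hh : Admissible X L h)
    {x y : ℝ} (hx : x ∈ X) (hy : y ∈ X) (hxy : x ≤ y) : derivWithin h X x ≤ derivWithin h X y :=
  hh.convex.monotoneOn_derivWithin hh.differentiableOn hx hy hxy

/-! ### Valid functions and the set of their minimizers -/

section Valid

section

variable {V : Type*}

theorem sum_add_sum_derivWithin_mul_le {X : Set ℝ} {L : ℝ} {h : V → ℝ → ℝ}
    (hh : ∀ i, Admissible X L (h i)) {N : Finset V} {α : V → ℝ} (hα : ∀ i ∈ N, 0 ≤ α i)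
    {x y : ℝ} (hx : x ∈ X) (hy : y ∈ X) :
    ∑ i ∈ N, α i * h i x + (∑ i ∈ N, α i * derivWithin (h i) X x) * (y - x) ≤
      ∑ i ∈ N, α i * h i y := by
  rw [Finset.sum_mul, ← Finset.sum_add_distrib]
  refine Finset.sum_le_sum fun i hi => ?_
  have := mul_le_mul_of_nonneg_left ((hh i).add_derivWithin_mul_le hx hy) (hα i hi)
  linarith

/-- A nonnegative combination of admissible functions attains its minimum. -/
theorem exists_mem_argminOn {X : Set ℝ} {L : ℝ} {h : V → ℝ → ℝ}
    (hh : ∀ i, Admissible X L (h i)) {N : Finset V} (hN : N.Nonempty) {α : V → ℝ}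
    (hα : ∀ i ∈ N, 0 ≤ α i) : ∃ z, z ∈ argminOn (fun y => ∑ i ∈ N, α i * h i y) X := by
  choose c hcX hc using fun i => (hh i).argmin_nonempty
  obtain ⟨i₀, hi₀, ha⟩ := N.exists_min_image c hN
  obtain ⟨i₁, hi₁, hb⟩ := N.exists_max_image c hN
  -- Minimize over the hull of the individual minimizers `c i`. From a point outside it, moving to
  -- the nearest end of the hull increases no `h i`.
  have hXo : X.OrdConnected := (hh i₀).convex.1.ordConnected
  have hsub : Set.Icc (c i₀) (c i₁) ⊆ X := hXo.out (hcX i₀) (hcX i₁)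
  have hcont : ContinuousOn (fun y => ∑ i ∈ N, α i * h i y) (Set.Icc (c i₀) (c i₁)) :=
    continuousOn_finsetSum _ fun i _ =>
      continuousOn_const.mul ((hh i).contDiff.continuousOn.mono hsub)
  obtain ⟨z, hz, hzmin⟩ := isCompact_Icc.exists_isMinOn
    (Set.nonempty_Icc.2 (ha i₁ hi₁)) hcont
  refine ⟨z, hsub hz, fun y hy => ?_⟩
  have key : ∀ b ∈ Set.Icc (c i₀) (c i₁), (∀ i ∈ N, h i b ≤ h i y) →
      ∑ i ∈ N, α i * h i z ≤ ∑ i ∈ N, α i * h i y := fun b hbI hle =>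
    (hzmin hbI).trans (Finset.sum_le_sum fun i hi => mul_le_mul_of_nonneg_left (hle i hi) (hα i hi))
  rcases lt_or_ge y (c i₀) with hlt | hge
  · refine key (c i₀) ⟨le_rfl, ha i₁ hi₁⟩ fun i hi => ?_
    exact ((hh i).convex.le_max_of_mem_Icc hy (hcX i) ⟨hlt.le, ha i hi⟩).trans
      (max_le le_rfl (hc i hy))
  · rcases lt_or_ge (c i₁) y with hlt | hge'
    · refine key (c i₁) ⟨ha i₁ hi₁, le_rfl⟩ fun i hi => ?_
      exact ((hh i).convex.le_max_of_mem_Icc (hcX i) hy ⟨hb i hi, hlt.le⟩).trans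
        (max_le (hc i hy) le_rfl)
    · exact key y ⟨hge, hge'⟩ fun i _ => le_rfl

/-- A finite union, over the possible sets of heavy indices, of closed sets. -/
theorem isClosed_setOf_le_card_filter [Finite V] (N : Finset V) (β γ : ℝ) :
    IsClosed {α : V → ℝ | γ ≤ ((N.filter fun i => β ≤ α i).card : ℝ)} := by
  classical
  have heq : {α : V → ℝ | γ ≤ ((N.filter fun i => β ≤ α i).card : ℝ)} =
      ⋃ I ∈ {I : Finset V | I ⊆ N ∧ γ ≤ (I.card : ℝ)}, ⋂ i ∈ I, {α : V → ℝ | β ≤ α i} := by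
    ext α
    simp only [Set.mem_ofPred_eq, Set.mem_iUnion, Set.mem_iInter, exists_prop]
    constructor
    · intro hα
      exact ⟨_, ⟨Finset.filter_subset _ _, hα⟩, fun i hi => (Finset.mem_filter.1 hi).2⟩
    · rintro ⟨I, ⟨hI, hγ⟩, hle⟩
      exact hγ.trans (Nat.cast_le.2 (Finset.card_le_card fun i hi =>
        Finset.mem_filter.2 ⟨hI hi, hle i hi⟩))
  rw [heq]
  refine (Set.toFinite _).isClosed_biUnion fun I _ => isClosed_biInter fun i _ => ?_
  exact isClosed_le continuous_const (continuous_apply i)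

end

variable {V : Type*} [Fintype V] [DecidableEq V]

open Classical in
/-- The weights of the valid functions. -/
def validWeights (F : Finset V) (β γ : ℝ) : Set (V → ℝ) :=
  {α | (∀ i ∈ Fᶜ, 0 ≤ α i) ∧ ∑ i ∈ Fᶜ, α i = 1 ∧
    γ ≤ ((Fᶜ.filter fun i => β ≤ α i).card : ℝ)}

theorem mem_optSet_iff {X : Set ℝ} {F : Finset V} {h : V → ℝ → ℝ} {β γ x : ℝ} :
    x ∈ optSet X F h β γ ↔
      ∃ α ∈ validWeights F β γ, x ∈ argminOn (fun y => ∑ i ∈ Fᶜ, α i * h i y) X := by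
  simp only [optSet, Set.mem_iUnion, validFunctions, Set.mem_ofPred_eq, validWeights, exists_prop]
  constructor
  · rintro ⟨p, ⟨α, h1, h2, h3, rfl⟩, hx⟩
    exact ⟨α, ⟨h1, h2, h3⟩, hx⟩
  · rintro ⟨α, ⟨h1, h2, h3⟩, hx⟩
    exact ⟨_, ⟨α, h1, h2, h3, rfl⟩, hx⟩

theorem optSet_subset {X : Set ℝ} {F : Finset V} {h : V → ℝ → ℝ} {β γ : ℝ} :
    optSet X F h β γ ⊆ X := by
  intro x hx
  obtain ⟨α, -, h1⟩ := mem_optSet_iff.1 hx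
  exact h1.1

variable {X : Set ℝ} {L : ℝ} {h : V → ℝ → ℝ} {F : Finset V} {β γ : ℝ}

/-- A minimizer lying to the left of `x`, where the slope is nonpositive, forces `x` to be a
minimizer too by the tangent inequality. -/
theorem exists_mem_optSet_ge (hh : ∀ i, Admissible X L (h i)) (hN : Fᶜ.Nonempty) {α : V → ℝ}
    (hα : α ∈ validWeights F β γ) {x : ℝ} (hx : x ∈ X)
    (hd : ∑ i ∈ Fᶜ, α i * derivWithin (h i) X x ≤ 0) : ∃ y ∈ optSet X F h β γ, x ≤ y := by
  obtain ⟨z, hz⟩ := exists_mem_argminOn hh hN hα.1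
  rcases le_total x z with hxz | hzx
  · exact ⟨z, mem_optSet_iff.2 ⟨α, hα, hz⟩, hxz⟩
  · refine ⟨x, mem_optSet_iff.2 ⟨α, hα, hx, fun y hy => ?_⟩, le_rfl⟩
    have h1 := sum_add_sum_derivWithin_mul_le hh hα.1 hx hz.1
    have h2 := mul_nonneg_of_nonpos_of_nonpos hd (sub_nonpos.2 hzx)
    have h3 := hz.2 hy
    simp only [Set.mem_ofPred_eq] at h3 ⊢
    linarith

theorem exists_mem_optSet_le (hh : ∀ i, Admissible X L (h i)) (hN : Fᶜ.Nonempty) {α : V → ℝ}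
    (hα : α ∈ validWeights F β γ) {x : ℝ} (hx : x ∈ X)
    (hd : 0 ≤ ∑ i ∈ Fᶜ, α i * derivWithin (h i) X x) : ∃ y ∈ optSet X F h β γ, y ≤ x := by
  obtain ⟨z, hz⟩ := exists_mem_argminOn hh hN hα.1
  rcases le_total z x with hzx | hxz
  · exact ⟨z, mem_optSet_iff.2 ⟨α, hα, hz⟩, hzx⟩
  · refine ⟨x, mem_optSet_iff.2 ⟨α, hα, hx, fun y hy => ?_⟩, le_rfl⟩
    have h1 := sum_add_sum_derivWithin_mul_le hh hα.1 hx hz.1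
    have h2 := mul_nonneg hd (sub_nonneg.2 hxz)
    have h3 := hz.2 hy
    simp only [Set.mem_ofPred_eq] at h3 ⊢
    linarith

/-- The uniform weights are valid, and the valid weights are star-shaped about them. -/
theorem combo_uniform_mem_validWeights (hN : Fᶜ.Nonempty) (hβ : β ≤ 1 / (Fᶜ.card : ℝ))
    {α : V → ℝ} (hα : α ∈ validWeights F β γ) {θ : ℝ} (h0 : 0 ≤ θ) (h1 : θ ≤ 1) :
    (fun i => θ * α i + (1 - θ) * (1 / (Fᶜ.card : ℝ))) ∈ validWeights F β γ := by
  have hm : (0 : ℝ) < Fᶜ.card := by exact_mod_cast hN.card_pos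
  refine ⟨fun i hi => ?_, ?_, ?_⟩
  · have := hα.1 i hi
    have : 0 ≤ 1 - θ := by linarith
    positivity
  · rw [Finset.sum_add_distrib, ← Finset.mul_sum, hα.2.1, Finset.sum_const, nsmul_eq_mul]
    field_simp
    ring
  · refine hα.2.2.trans (Nat.cast_le.2 (Finset.card_le_card fun i hi => ?_))
    simp only [Finset.mem_filter] at hi ⊢
    refine ⟨hi.1, ?_⟩
    nlinarith [mul_le_mul_of_nonneg_left hi.2 h0,
      mul_le_mul_of_nonneg_left hβ (sub_nonneg.2 h1)]

theorem uniform_mem_validWeights (hN : Fᶜ.Nonempty) (hβ : β ≤ 1 / (Fᶜ.card : ℝ))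
    (hγ : γ ≤ (Fᶜ.card : ℝ)) : (fun _ => 1 / (Fᶜ.card : ℝ)) ∈ validWeights F β γ := by
  have hm : (0 : ℝ) < Fᶜ.card := by exact_mod_cast hN.card_pos
  refine ⟨fun i _ => by positivity, ?_, ?_⟩
  · rw [Finset.sum_const, nsmul_eq_mul]
    field_simp
  · simpa only [hβ, Finset.filter_true] using hγ

theorem optSet_nonempty (hh : ∀ i, Admissible X L (h i)) (hN : Fᶜ.Nonempty)
    (hβ : β ≤ 1 / (Fᶜ.card : ℝ)) (hγ : γ ≤ (Fᶜ.card : ℝ)) : (optSet X F h β γ).Nonempty := by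
  have hu := uniform_mem_validWeights hN hβ hγ
  obtain ⟨z, hz⟩ := exists_mem_argminOn hh hN hu.1
  exact ⟨z, mem_optSet_iff.2 ⟨_, hu, hz⟩⟩

theorem mem_optSet_of_sum_derivWithin_eq_zero (hh : ∀ i, Admissible X L (h i)) {α : V → ℝ}
    (hα : α ∈ validWeights F β γ) {x : ℝ} (hx : x ∈ X)
    (hd : ∑ i ∈ Fᶜ, α i * derivWithin (h i) X x = 0) : x ∈ optSet X F h β γ := by
  refine mem_optSet_iff.2 ⟨α, hα, hx, fun y hy => ?_⟩
  have h1 := sum_add_sum_derivWithin_mul_le hh hα.1 hx hy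
  rw [hd] at h1
  simp only [Set.mem_ofPred_eq]
  linarith

/-- Two valid weights may be heavy on different agents, so their mixtures need not be valid; mixing
with the uniform weights is always allowed. Between two optima one valid slope is nonnegative and
another nonpositive. Mixing uniform weights with the one of opposite sign gives a valid function
with slope 0 at `x`. -/
theorem optSet_ordConnected (hh : ∀ i, Admissible X L (h i)) (hX : X.OrdConnected)
    (hN : Fᶜ.Nonempty) (hβ : β ≤ 1 / (Fᶜ.card : ℝ)) : (optSet X F h β γ).OrdConnected := by
  refine ⟨fun y₁ hy₁ y₂ hy₂ x hx => ?_⟩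
  have hxX : x ∈ X := hX.out (optSet_subset hy₁) (optSet_subset hy₂) hx
  rcases eq_or_lt_of_le hx.1 with rfl | hlt₁
  · exact hy₁
  rcases eq_or_lt_of_le hx.2 with rfl | hlt₂
  · exact hy₂
  obtain ⟨α₁, hα₁, hm₁⟩ := mem_optSet_iff.1 hy₁
  obtain ⟨α₂, hα₂, hm₂⟩ := mem_optSet_iff.1 hy₂
  set d : V → ℝ := fun i => derivWithin (h i) X x
  have hd₁ : 0 ≤ ∑ i ∈ Fᶜ, α₁ i * d i := by
    have h1 := sum_add_sum_derivWithin_mul_le hh hα₁.1 hxX hm₁.1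
    have h2 := hm₁.2 hxX
    simp only [Set.mem_ofPred_eq] at h2
    by_contra! hneg
    have := mul_pos_of_neg_of_neg hneg (sub_neg.2 hlt₁)
    linarith
  have hd₂ : ∑ i ∈ Fᶜ, α₂ i * d i ≤ 0 := by
    have h1 := sum_add_sum_derivWithin_mul_le hh hα₂.1 hxX hm₂.1
    have h2 := hm₂.2 hxX
    simp only [Set.mem_ofPred_eq] at h2
    by_contra! hpos
    have := mul_pos hpos (sub_pos.2 hlt₂)
    linarith
  set u : ℝ := ∑ i ∈ Fᶜ, 1 / (Fᶜ.card : ℝ) * d i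
  have key : ∀ α ∈ validWeights F β γ, ∀ θ : ℝ, 0 ≤ θ → θ ≤ 1 →
      θ * (∑ i ∈ Fᶜ, α i * d i) + (1 - θ) * u = 0 → x ∈ optSet X F h β γ := by
    intro α hα θ h0 h1 hz
    refine mem_optSet_of_sum_derivWithin_eq_zero hh
      (combo_uniform_mem_validWeights hN hβ hα h0 h1) hxX ?_
    rw [← hz, Finset.mul_sum, Finset.mul_sum, ← Finset.sum_add_distrib]
    exact Finset.sum_congr rfl fun i _ => by ring
  rcases le_total 0 u with hu | hu
  · obtain ⟨θ, h1, h2, h3, h4, h5⟩ : ∃ a b : ℝ, 0 ≤ a ∧ 0 ≤ b ∧ a + b = 1 ∧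
        a * (∑ i ∈ Fᶜ, α₂ i * d i) + b * u = 0 := by
      have h0 : (0 : ℝ) ∈ segment ℝ (∑ i ∈ Fᶜ, α₂ i * d i) u := by
        rw [segment_eq_Icc (hd₂.trans hu)]; exact ⟨hd₂, hu⟩
      simpa [segment] using h0
    refine key α₂ hα₂ θ h2 (by linarith) ?_
    rw [← h5, ← h4]; ring
  · obtain ⟨θ, h1, h2, h3, h4, h5⟩ : ∃ a b : ℝ, 0 ≤ a ∧ 0 ≤ b ∧ a + b = 1 ∧
        a * (∑ i ∈ Fᶜ, α₁ i * d i) + b * u = 0 := by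
      have h0 : (0 : ℝ) ∈ segment ℝ (∑ i ∈ Fᶜ, α₁ i * d i) u := by
        rw [segment_symm, segment_eq_Icc (hu.trans hd₁)]; exact ⟨hu, hd₁⟩
      simpa [segment] using h0
    refine key α₁ hα₁ θ h2 (by linarith) ?_
    rw [← h5, ← h4]; ring

/-- A linear form that is positive on all valid weights is bounded away from `0` on them. -/
theorem exists_pos_le_sum_validWeights {d : V → ℝ}
    (hpos : ∀ α ∈ validWeights F β γ, 0 < ∑ i ∈ Fᶜ, α i * d i) :
    ∃ δ > 0, ∀ α ∈ validWeights F β γ, δ ≤ ∑ i ∈ Fᶜ, α i * d i := by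
  -- Weights on `F` are unconstrained; setting them to 0 changes no sum over `Fᶜ` and makes the set
  -- compact.
  let K : Set (V → ℝ) := Set.Icc 0 1 ∩ ({α | ∑ i ∈ Fᶜ, α i = 1} ∩
    {α | γ ≤ ((Fᶜ.filter fun i => β ≤ α i).card : ℝ)})
  have hK : IsCompact K := isCompact_Icc.inter_right <|
    (isClosed_eq (continuous_finsetSum _ fun i _ => continuous_apply i) continuous_const).inter
      (isClosed_setOf_le_card_filter _ _ _)
  have hKsub : ∀ α ∈ K, α ∈ validWeights F β γ := fun α hα =>
    ⟨fun i _ => hα.1.1 i, hα.2.1, by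
      have hγ := hα.2.2
      rw [Set.mem_ofPred_eq] at hγ
      convert hγ⟩
  have hred : ∀ α ∈ validWeights F β γ, (fun i => if i ∈ Fᶜ then α i else 0) ∈ K := by
    intro α hα
    have hsum : ∑ i ∈ Fᶜ, (if i ∈ Fᶜ then α i else 0) = 1 := by
      rw [← hα.2.1]
      exact Finset.sum_congr rfl fun i hi => if_pos hi
    refine ⟨⟨fun i => ?_, fun i => ?_⟩, hsum, ?_⟩
    · by_cases hi : i ∈ Fᶜ
      · simp only [if_pos hi, Pi.zero_apply]
        exact hα.1 i hi
      · simp only [if_neg hi]; exact le_rfl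
    · by_cases hi : i ∈ Fᶜ
      · simp only [if_pos hi, Pi.one_apply]
        rw [← hα.2.1]
        exact Finset.single_le_sum hα.1 hi
      · simp only [if_neg hi]; exact zero_le_one
    · refine hα.2.2.trans (Nat.cast_le.2 (Finset.card_le_card fun i hi => ?_))
      simp only [Finset.mem_filter] at hi ⊢
      exact ⟨hi.1, by rw [if_pos hi.1]; exact hi.2⟩
  have hval : ∀ α : V → ℝ, ∑ i ∈ Fᶜ, (if i ∈ Fᶜ then α i else 0) * d i = ∑ i ∈ Fᶜ, α i * d i :=
    fun α => Finset.sum_congr rfl fun i hi => by rw [if_pos hi]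
  rcases K.eq_empty_or_nonempty with hE | hne
  · exact ⟨1, one_pos, fun α hα => absurd (hred α hα) (hE ▸ Set.notMem_empty _)⟩
  · have hcont : ContinuousOn (fun α : V → ℝ => ∑ i ∈ Fᶜ, α i * d i) K :=
      (continuous_finsetSum _ fun i _ => (continuous_apply i).mul continuous_const).continuousOn
    obtain ⟨α₀, hα₀, hmin⟩ := hK.exists_isMinOn hne hcont
    refine ⟨_, hpos α₀ (hKsub α₀ hα₀), fun α hα => ?_⟩
    rw [← hval α]
    exact hmin (hred α hα)

/-- A nonpositive valid slope at `x` would produce a point of `Y` at or beyond `x`; compactness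
makes the positivity uniform. -/
theorem exists_pos_le_sum_derivWithin (hh : ∀ i, Admissible X L (h i)) (hN : Fᶜ.Nonempty) {x : ℝ}
    (hx : x ∈ X) (hY : ∀ y ∈ optSet X F h β γ, y < x) :
    ∃ δ > 0, ∀ α ∈ validWeights F β γ, δ ≤ ∑ i ∈ Fᶜ, α i * derivWithin (h i) X x := by
  refine exists_pos_le_sum_validWeights fun α hα => ?_
  by_contra! hle
  obtain ⟨y, hy, hxy⟩ := exists_mem_optSet_ge hh hN hα hx hle
  exact absurd (hY y hy) (not_lt.2 hxy)

theorem exists_pos_sum_derivWithin_le (hh : ∀ i, Admissible X L (h i)) (hN : Fᶜ.Nonempty) {x : ℝ}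
    (hx : x ∈ X) (hY : ∀ y ∈ optSet X F h β γ, x < y) :
    ∃ δ > 0, ∀ α ∈ validWeights F β γ, ∑ i ∈ Fᶜ, α i * derivWithin (h i) X x ≤ -δ := by
  obtain ⟨δ, hδ, hle⟩ := exists_pos_le_sum_validWeights (F := F) (β := β) (γ := γ)
    (d := fun i => -derivWithin (h i) X x) fun α hα => by
      simp only [mul_neg, Finset.sum_neg_distrib, Left.neg_pos_iff]
      by_contra! hge
      obtain ⟨y, hy, hxy⟩ := exists_mem_optSet_le hh hN hα hx hge
      exact absurd (hY y hy) (not_lt.2 hxy)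
  refine ⟨δ, hδ, fun α hα => ?_⟩
  have := hle α hα
  simp only [mul_neg, Finset.sum_neg_distrib] at this
  linarith

end Valid

/-! ### Contraction of the diameter -/

section Consensus

/-- Every averaged value is at most `B`, and one of them is at most `B - ε`. A uniform bound `K` on
the number of terms gives the same contraction constant for all agents. -/
theorem IsTrimmed.mean_le {V : Type*} [DecidableEq V] {A R F : Finset V} {w : V → ℝ} {f : ℕ}
    {j : V} (hR : IsTrimmed A w f R) (hF : F.card ≤ f) (hjA : j ∉ A)
    (hA : 0 < f → 2 * f < A.card) {B ε K : ℝ} (hε : 0 ≤ ε) (hK : (R.card : ℝ) + 1 ≤ K)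
    (hB : ∀ i ∈ insert j A, i ∉ F → w i ≤ B) (hjF : j ∉ F)
    (hlow : w j ≤ B - ε ∨ ∃ D ⊆ A, f < D.card ∧ ∀ i ∈ D, w i ≤ B - ε) :
    1 / ((R.card : ℝ) + 1) * ∑ i ∈ insert j R, w i ≤ B - 1 / K * ε := by
  have hjR : j ∉ R := fun hj => hjA (hR.subset hj)
  have hall : ∀ i ∈ insert j R, w i ≤ B := by
    intro i hi
    rcases Finset.mem_insert.1 hi with rfl | hi
    · exact hB i (Finset.mem_insert_self _ _) hjF
    · obtain ⟨u, hu, hle⟩ := hR.exists_le hF hi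
      rw [Finset.mem_sdiff] at hu
      exact hle.trans (hB u (Finset.mem_insert_of_mem hu.1) hu.2)
  obtain ⟨r, hr, hrle⟩ : ∃ r ∈ insert j R, w r ≤ B - ε := by
    rcases hlow with hj | ⟨D, hDA, hD, hle⟩
    · exact ⟨j, Finset.mem_insert_self _ _, hj⟩
    · have hc := hR.card_add
      have hDc := Finset.card_le_card hDA
      have hne : R.Nonempty := by
        rw [← Finset.card_pos]
        rcases Nat.eq_zero_or_pos f with rfl | hf
        · omega
        · have := hA hf
          omega
      obtain ⟨r, hr, hrle⟩ := hR.exists_mem_le hne hDA hD hle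
      exact ⟨r, Finset.mem_insert_of_mem hr, hrle⟩
  have hsum : ∑ i ∈ insert j R, w i ≤ ((R.card : ℝ) + 1) * B - ε := by
    rw [← Finset.add_sum_erase _ _ hr]
    have h1 : ∑ i ∈ (insert j R).erase r, w i ≤ (R.card : ℝ) * B := by
      have h2 := Finset.sum_le_card_nsmul ((insert j R).erase r) w B
        fun i hi => hall i (Finset.mem_of_mem_erase hi)
      rw [Finset.card_erase_of_mem hr, Finset.card_insert_of_notMem hjR, Nat.add_sub_cancel,
        nsmul_eq_mul] at h2
      exact h2
    linarith
  have hpos : (0 : ℝ) < (R.card : ℝ) + 1 := by positivity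
  calc 1 / ((R.card : ℝ) + 1) * ∑ i ∈ insert j R, w i
      ≤ 1 / ((R.card : ℝ) + 1) * (((R.card : ℝ) + 1) * B - ε) :=
        mul_le_mul_of_nonneg_left hsum (by positivity)
    _ = B - 1 / ((R.card : ℝ) + 1) * ε := by field_simp
    _ ≤ B - 1 / K * ε := by
        have := mul_le_mul_of_nonneg_right (one_div_le_one_div_of_le hpos hK) hε
        linarith

/-- If `D` contracts by a fixed factor in every `n` steps, up to an error that tends to `0`, then
`D` tends to `0`. -/
theorem tendsto_zero_of_le_mul_add {D e : ℕ → ℝ} {ρ : ℝ} {n : ℕ} (hn : 0 < n) (hρ0 : 0 ≤ ρ)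
    (hρ1 : ρ < 1) (hD : ∀ t, 0 ≤ D t) (hstep : ∀ t, D (t + n) ≤ ρ * D t + e t)
    (he : Tendsto e atTop (𝓝 0)) : Tendsto D atTop (𝓝 0) := by
  have hup : ∀ ε > 0, ∀ᶠ t in atTop, D t ≤ 2 * ε := by
    intro ε hε
    -- Errors below `(1 - ρ) * ε` make `ε` an upper bound for the fixed point of the recursion.
    have hpos : 0 < (1 - ρ) * ε := mul_pos (by linarith) hε
    obtain ⟨T, hT⟩ := eventually_atTop.1 (he.eventually (gt_mem_nhds hpos))
    obtain ⟨C, hC⟩ : ∃ C, ∀ r < n, D (T + r) ≤ C := by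
      refine ⟨∑ r ∈ Finset.range n, D (T + r), fun r hr => ?_⟩
      exact Finset.single_le_sum (f := fun r => D (T + r)) (fun r _ => hD _)
        (Finset.mem_range.2 hr)
    have hC0 : 0 ≤ C := (hD _).trans (hC 0 hn)
    have hgeo : ∀ k, ∀ r < n, D (T + r + k * n) ≤ ε + ρ ^ k * C := by
      intro k r hr
      induction k with
      | zero => simpa using (hC r hr).trans (by linarith)
      | succ k ih =>
        have h1 := hstep (T + r + k * n)
        have h2 := hT (T + r + k * n) (by omega)
        have h3 := mul_le_mul_of_nonneg_left ih hρ0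
        rw [show T + r + (k + 1) * n = T + r + k * n + n by ring, pow_succ]
        nlinarith
    have hlim : Tendsto (fun k : ℕ => ρ ^ k * C) atTop (𝓝 0) := by
      simpa using (tendsto_pow_atTop_nhds_zero_of_lt_one hρ0 hρ1).mul_const C
    obtain ⟨k₀, hk₀⟩ := eventually_atTop.1 (hlim.eventually (gt_mem_nhds hε))
    refine eventually_atTop.2 ⟨T + k₀ * n, fun t ht => ?_⟩
    have h1 := hgeo ((t - T) / n) ((t - T) % n) (Nat.mod_lt _ hn)
    have h2 := hk₀ ((t - T) / n) ((Nat.le_div_iff_mul_le hn).2 (by omega))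
    have h3 : T + (t - T) % n + (t - T) / n * n = t := by
      have := Nat.mod_add_div' (t - T) n
      omega
    rw [h3] at h1
    linarith
  refine tendsto_order.2 ⟨fun a ha => Eventually.of_forall fun t => ha.trans_le (hD t),
    fun a ha => ?_⟩
  filter_upwards [hup (a / 3) (by linarith)] with t ht
  linarith

variable {V : Type*} [Fintype V] [DecidableEq V]

/-- Agent `j`, or more than `f` of its incoming neighbours outside `F`, have a value at most `c`. -/
def PulledBelow (G : Digraph V) (F : Finset V) (f : ℕ) (x : V → ℝ) (j : V) (c : ℝ) : Prop :=
  x j ≤ c ∨ ∃ D ⊆ inNbrs G j \ F, f < D.card ∧ ∀ i ∈ D, x i ≤ c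

/-- While agents near the top and agents near the bottom both exist, one of the two groups loses a
member in every step; hence after `|Fᶜ|` steps one of them is empty. -/
theorem consensus_contraction {G : Digraph V} {F : Finset V} {f : ℕ}
    (hG : EveryReducedGraphHasSource G f) (hF : F.card ≤ f) {y : ℕ → V → ℝ} {μ e : ℝ}
    (hμ0 : 0 ≤ μ) (hμ1 : μ ≤ 1) (he : 0 ≤ e)
    (hup : ∀ k, ∀ j, j ∉ F → ∀ B ε, 0 ≤ ε → (∀ i, i ∉ F → y k i ≤ B) →
      PulledBelow G F f (y k) j (B - ε) → y (k + 1) j ≤ B - μ * ε + e)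
    (hdown : ∀ k, ∀ j, j ∉ F → ∀ B ε, 0 ≤ ε → (∀ i, i ∉ F → -y k i ≤ B) →
      PulledBelow G F f (fun i => -y k i) j (B - ε) → -y (k + 1) j ≤ B - μ * ε + e)
    {B b : ℝ} (hB : ∀ i, i ∉ F → y 0 i ≤ B) (hb : ∀ i, i ∉ F → -y 0 i ≤ -b) (hbB : b ≤ B) :
    (∀ i, i ∉ F → y Fᶜ.card i ≤ B + Fᶜ.card * e) ∧
    (∀ i, i ∉ F → -y Fᶜ.card i ≤ -b + Fᶜ.card * e) ∧
    ((∀ i, i ∉ F → y Fᶜ.card i ≤ B + Fᶜ.card * e - μ ^ Fᶜ.card * ((B - b) / 2)) ∨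
      (∀ i, i ∉ F → -y Fᶜ.card i ≤ -b + Fᶜ.card * e - μ ^ Fᶜ.card * ((B - b) / 2))) := by
  have hε : ∀ k : ℕ, 0 ≤ μ ^ k * ((B - b) / 2) := fun k =>
    mul_nonneg (pow_nonneg hμ0 k) (by linarith)
  have hB' : ∀ k : ℕ, ∀ i, i ∉ F → y k i ≤ B + k * e := by
    intro k
    induction k with
    | zero => simpa using hB
    | succ k ih =>
      intro i hi
      have := hup k i hi (B + k * e) 0 le_rfl ih (Or.inl (by simpa using ih i hi))
      push_cast
      linarith
  have hb' : ∀ k : ℕ, ∀ i, i ∉ F → -y k i ≤ -b + k * e := by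
    intro k
    induction k with
    | zero => simpa using hb
    | succ k ih =>
      intro i hi
      have := hdown k i hi (-b + k * e) 0 le_rfl ih (Or.inl (by simpa using ih i hi))
      push_cast
      linarith
  -- The top and bottom groups. The margin shrinks by `μ` in each step, exactly what a pulled agent
  -- retains; starting from half of the width keeps the groups disjoint.
  let P : ℕ → Finset V := fun k => Fᶜ.filter fun i => B + k * e - μ ^ k * ((B - b) / 2) < y k i
  let Q : ℕ → Finset V := fun k => Fᶜ.filter fun i => -b + k * e - μ ^ k * ((B - b) / 2) < -y k i
  have hPstep : ∀ k j, j ∉ F →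
      PulledBelow G F f (y k) j (B + k * e - μ ^ k * ((B - b) / 2)) → j ∉ P (k + 1) := by
    intro k j hj hpull hmem
    have h1 := hup k j hj (B + k * e) _ (hε k) (hB' k) hpull
    have h2 := (Finset.mem_filter.1 hmem).2
    rw [pow_succ] at h2
    push_cast at h2
    linarith
  have hQstep : ∀ k j, j ∉ F →
      PulledBelow G F f (fun i => -y k i) j (-b + k * e - μ ^ k * ((B - b) / 2)) →
      j ∉ Q (k + 1) := by
    intro k j hj hpull hmem
    have h1 := hdown k j hj (-b + k * e) _ (hε k) (hb' k) hpull
    have h2 := (Finset.mem_filter.1 hmem).2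
    rw [pow_succ] at h2
    push_cast at h2
    linarith
  have hPsub : ∀ k, P (k + 1) ⊆ P k := by
    intro k j hj
    have hjF := (Finset.mem_filter.1 hj).1
    by_contra hn
    refine hPstep k j (Finset.mem_compl.1 hjF) (Or.inl ?_) hj
    by_contra! hlt
    exact hn (Finset.mem_filter.2 ⟨hjF, hlt⟩)
  have hQsub : ∀ k, Q (k + 1) ⊆ Q k := by
    intro k j hj
    have hjF := (Finset.mem_filter.1 hj).1
    by_contra hn
    refine hQstep k j (Finset.mem_compl.1 hjF) (Or.inl ?_) hj
    by_contra! hlt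
    exact hn (Finset.mem_filter.2 ⟨hjF, hlt⟩)
  have hdisj : ∀ k, Disjoint (P k) (Q k) := by
    intro k
    refine Finset.disjoint_left.2 fun i hi hi' => ?_
    have h1 := (Finset.mem_filter.1 hi).2
    have h2 := (Finset.mem_filter.1 hi').2
    have h3 : μ ^ k * ((B - b) / 2) ≤ (B - b) / 2 :=
      mul_le_of_le_one_left (by linarith) (pow_le_one₀ hμ0 hμ1)
    have h4 : 0 ≤ (k : ℝ) * e := by positivity
    linarith
  have hsubF : ∀ k, Disjoint (P k) F ∧ Disjoint (Q k) F := fun k =>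
    ⟨Finset.disjoint_left.2 fun i hi => Finset.mem_compl.1 (Finset.mem_filter.1 hi).1,
      Finset.disjoint_left.2 fun i hi => Finset.mem_compl.1 (Finset.mem_filter.1 hi).1⟩
  -- While both groups are nonempty, a member of one hears more than `f` non-faulty agents outside
  -- its group and leaves it.
  have hmain : ∀ k, P k = ∅ ∨ Q k = ∅ ∨ (P k).card + (Q k).card + k ≤ Fᶜ.card := by
    intro k
    induction k with
    | zero =>
      refine Or.inr (Or.inr ?_)
      rw [add_zero, ← Finset.card_union_of_disjoint (hdisj 0)]
      exact Finset.card_le_card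
        (Finset.union_subset (Finset.filter_subset _ _) (Finset.filter_subset _ _))
    | succ k ih =>
      rcases ih with h | h | h
      · exact Or.inl (Finset.subset_empty.1 (h ▸ hPsub k))
      · exact Or.inr (Or.inl (Finset.subset_empty.1 (h ▸ hQsub k)))
      rcases (P k).eq_empty_or_nonempty with hPe | hPne
      · exact Or.inl (Finset.subset_empty.1 (hPe ▸ hPsub k))
      rcases (Q k).eq_empty_or_nonempty with hQe | hQne
      · exact Or.inr (Or.inl (Finset.subset_empty.1 (hQe ▸ hQsub k)))
      have hPc := Finset.card_le_card (hPsub k)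
      have hQc := Finset.card_le_card (hQsub k)
      refine Or.inr (Or.inr ?_)
      rcases hG.exists_card_lt hF hPne hQne (hdisj k) (hsubF k).1 (hsubF k).2 with
        ⟨i, hi, hlt⟩ | ⟨i, hi, hlt⟩
      · have hnot : i ∉ P (k + 1) := by
          refine hPstep k i (Finset.disjoint_left.1 (hsubF k).1 hi)
            (Or.inr ⟨_, Finset.sdiff_subset, hlt, fun l hl => ?_⟩)
          simp only [Finset.mem_sdiff, P, Finset.mem_filter, Finset.mem_compl, not_and,
            not_lt] at hl
          exact hl.2 hl.1.2
        have := Finset.card_lt_card ((Finset.ssubset_iff_of_subset (hPsub k)).2 ⟨i, hi, hnot⟩)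
        omega
      · have hnot : i ∉ Q (k + 1) := by
          refine hQstep k i (Finset.disjoint_left.1 (hsubF k).2 hi)
            (Or.inr ⟨_, Finset.sdiff_subset, hlt, fun l hl => ?_⟩)
          simp only [Finset.mem_sdiff, Q, Finset.mem_filter, Finset.mem_compl, not_and,
            not_lt] at hl
          exact hl.2 hl.1.2
        have := Finset.card_lt_card ((Finset.ssubset_iff_of_subset (hQsub k)).2 ⟨i, hi, hnot⟩)
        omega
  refine ⟨hB' _, hb' _, ?_⟩
  have hP : P Fᶜ.card = ∅ ∨ Q Fᶜ.card = ∅ := by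
    rcases hmain Fᶜ.card with h | h | h
    · exact Or.inl h
    · exact Or.inr h
    · exact Or.inl (Finset.card_eq_zero.1 (by omega))
  refine hP.imp (fun h i hi => ?_) fun h i hi => ?_
  · have := Finset.filter_eq_empty_iff.1 h (Finset.mem_compl.2 hi)
    exact not_lt.1 this
  · have := Finset.filter_eq_empty_iff.1 h (Finset.mem_compl.2 hi)
    exact not_lt.1 this

/-- The diameter of the non-faulty estimates tends to `0`. -/
theorem tendsto_spread {G : Digraph V} {F : Finset V} {f : ℕ}
    (hG : EveryReducedGraphHasSource G f) (hF : F.card ≤ f) (hN : Fᶜ.Nonempty) {x : ℕ → V → ℝ}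
    {μ : ℝ} {e : ℕ → ℝ} (hμ0 : 0 < μ) (hμ1 : μ ≤ 1) (he0 : ∀ t, 0 ≤ e t) (hanti : Antitone e)
    (helim : Tendsto e atTop (𝓝 0))
    (hup : ∀ t, ∀ j, j ∉ F → ∀ B ε, 0 ≤ ε → (∀ i, i ∉ F → x t i ≤ B) →
      PulledBelow G F f (x t) j (B - ε) → x (t + 1) j ≤ B - μ * ε + e t)
    (hdown : ∀ t, ∀ j, j ∉ F → ∀ B ε, 0 ≤ ε → (∀ i, i ∉ F → -x t i ≤ B) →
      PulledBelow G F f (fun i => -x t i) j (B - ε) → -x (t + 1) j ≤ B - μ * ε + e t) :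
    Tendsto (fun t => Fᶜ.sup' hN (x t) - Fᶜ.inf' hN (x t)) atTop (𝓝 0) := by
  have hle : ∀ t, ∀ i, i ∉ F → x t i ≤ Fᶜ.sup' hN (x t) := fun t i hi =>
    Finset.le_sup' (x t) (Finset.mem_compl.2 hi)
  have hge : ∀ t, ∀ i, i ∉ F → Fᶜ.inf' hN (x t) ≤ x t i := fun t i hi =>
    Finset.inf'_le (x t) (Finset.mem_compl.2 hi)
  have hnn : ∀ t, Fᶜ.inf' hN (x t) ≤ Fᶜ.sup' hN (x t) := fun t => by
    obtain ⟨i, hi⟩ := hN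
    exact (hge t i (Finset.mem_compl.1 hi)).trans (hle t i (Finset.mem_compl.1 hi))
  have hpow : μ ^ Fᶜ.card ≤ 1 := pow_le_one₀ hμ0.le hμ1
  have hpow0 : 0 < μ ^ Fᶜ.card := pow_pos hμ0 _
  -- One end moves inwards by `μ ^ n` times half of the width, where `n = |Fᶜ|`, and each end moves
  -- outwards by at most `n * e t`.
  refine tendsto_zero_of_le_mul_add (e := fun t => 2 * Fᶜ.card * e t)
    (ρ := 1 - μ ^ Fᶜ.card / 2) hN.card_pos (by linarith) (by linarith)
    (fun t => sub_nonneg.2 (hnn t)) (fun t => ?_) (by simpa using helim.const_mul (2 * Fᶜ.card : ℝ))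
  obtain ⟨h1, h2, h3⟩ := consensus_contraction hG hF (y := fun k => x (t + k)) hμ0.le hμ1 (he0 t)
    (fun k j hj B ε hε hB hp => (hup (t + k) j hj B ε hε hB hp).trans
      (by have := hanti (Nat.le_add_right t k); linarith))
    (fun k j hj B ε hε hB hp => (hdown (t + k) j hj B ε hε hB hp).trans
      (by have := hanti (Nat.le_add_right t k); linarith))
    (hle t) (fun i hi => neg_le_neg (hge t i hi)) (hnn t)
  have hsup : ∀ c, (∀ i, i ∉ F → x (t + Fᶜ.card) i ≤ c) → Fᶜ.sup' hN (x (t + Fᶜ.card)) ≤ c :=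
    fun c hc => Finset.sup'_le hN _ fun i hi => hc i (Finset.mem_compl.1 hi)
  have hinf : ∀ c, (∀ i, i ∉ F → -x (t + Fᶜ.card) i ≤ c) → -c ≤ Fᶜ.inf' hN (x (t + Fᶜ.card)) :=
    fun c hc => Finset.le_inf' hN _ fun i hi => neg_le.1 (hc i (Finset.mem_compl.1 hi))
  have h1' := hsup _ h1
  have h2' := hinf _ h2
  rcases h3 with h3 | h3
  · have h3' := hsup _ h3
    linarith
  · have h3' := hinf _ h3
    linarith

end Consensus

/-! ### Scalar descent -/

/-- A sequence that descends by `δ * lam t` above the level `c`, and otherwise rises by at most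
`η`, eventually stays below `c + η`. -/
theorem eventually_le_of_descent {M lam : ℕ → ℝ} {c η δ : ℝ} (hδ : 0 < δ) (hlam : ∀ t, 0 ≤ lam t)
    (hsum : Tendsto (fun n => ∑ t ∈ Finset.range n, lam t) atTop atTop) (hη : 0 ≤ η)
    (hdesc : ∀ᶠ t in atTop, c < M t → M (t + 1) ≤ max (M t - lam t * δ) c)
    (hrise : ∀ᶠ t in atTop, M t ≤ c → M (t + 1) ≤ c + η) :
    ∀ᶠ t in atTop, M t ≤ c + η := by
  obtain ⟨T, hT⟩ := eventually_atTop.1 (hdesc.and hrise)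
  -- Staying above `c` forever would push `M` to `-∞`, since the stepsizes are not summable.
  have hex : ∃ t ≥ T, M t ≤ c := by
    by_contra! hgt
    have hbound : ∀ k, M (T + k) ≤ M T - δ * (∑ t ∈ Finset.range (T + k), lam t -
        ∑ t ∈ Finset.range T, lam t) := by
      intro k
      induction k with
      | zero => simp
      | succ k ih =>
        have h1 := (hT (T + k) (by omega)).1 (hgt (T + k) (by omega))
        have h2 := hgt (T + k + 1) (by omega)
        have h3 : M (T + k + 1) ≤ M (T + k) - lam (T + k) * δ :=
          (le_max_iff.1 h1).resolve_right (not_le.2 h2)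
        rw [← add_assoc, Finset.sum_range_succ]
        linarith
    obtain ⟨n, hnT, hn⟩ := ((eventually_ge_atTop T).and (hsum.eventually_ge_atTop
      (∑ t ∈ Finset.range T, lam t + (M T - c) / δ))).exists
    have h1 := hbound (n - T)
    rw [Nat.add_sub_of_le hnT] at h1
    have h2 := hgt n hnT
    have h3 : (M T - c) ≤ δ * (∑ t ∈ Finset.range n, lam t - ∑ t ∈ Finset.range T, lam t) := by
      rw [← div_le_iff₀' hδ]; linarith
    linarith
  obtain ⟨t₀, ht₀, hM⟩ := hex
  refine eventually_atTop.2 ⟨t₀, fun t ht => ?_⟩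
  induction t, ht using Nat.le_induction with
  | base => linarith
  | succ t ht ih =>
    rcases le_or_gt (M t) c with hle | hgt
    · exact (hT t (ht₀.trans ht)).2 hle
    · refine ((hT t (ht₀.trans ht)).1 hgt).trans (max_le ?_ (by linarith))
      have := mul_nonneg (hlam t) hδ.le
      linarith

/-! ### Updates as projected gradient steps -/

section Algorithm

variable {V : Type*} [Fintype V] [DecidableEq V]

theorem card_insert_inNbrs_sdiff {G : Digraph V} (hloop : ∀ i, ¬ G.Adj i i) {F : Finset V} {j : V}
    (hj : j ∉ F) :
    (insert j (inNbrs G j) \ F).card + (inNbrs G j ∩ F).card = inDeg G j + 1 := by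
  have hjn : j ∉ inNbrs G j := by simp [inNbrs, hloop]
  rw [← Finset.insert_inter_of_notMem hj, Finset.card_sdiff_add_card_inter,
    Finset.card_insert_of_notMem hjn, inDeg]

theorem gammaTilde_le_card {G : Digraph V} (hloop : ∀ i, ¬ G.Adj i i) (F : Finset V) (f : ℕ)
    (hN : Fᶜ.Nonempty) : gammaTilde G F f hN ≤ (Fᶜ.card : ℝ) := by
  obtain ⟨j, hj⟩ := id hN
  refine (Finset.inf'_le _ hj).trans ?_
  have h1 := card_insert_inNbrs_sdiff hloop (Finset.mem_compl.1 hj)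
  have h2 : (insert j (inNbrs G j) \ F).card ≤ Fᶜ.card :=
    Finset.card_le_card fun i hi => Finset.mem_compl.2 (Finset.mem_sdiff.1 hi).2
  have h1' : ((insert j (inNbrs G j) \ F).card : ℝ) + ((inNbrs G j ∩ F).card : ℝ) =
      (inDeg G j : ℝ) + 1 := by exact_mod_cast h1
  have h2' : ((insert j (inNbrs G j) \ F).card : ℝ) ≤ (Fᶜ.card : ℝ) := by exact_mod_cast h2
  have h3 : (0 : ℝ) ≤ f := Nat.cast_nonneg f
  rw [slack]
  linarith

/-- The gradient used in an update is a combination, with valid weights, of the non-faulty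
gradients. -/
theorem exists_validWeights_of_isTrimmed {G : Digraph V} (hloop : ∀ i, ¬ G.Adj i i)
    {F : Finset V} {f : ℕ} (hF : F.card ≤ f) (hN : Fᶜ.Nonempty) {j : V} (hj : j ∉ F)
    {g : V → ℝ} {R : Finset V} (hR : IsTrimmed (insert j (inNbrs G j)) g f R) {gmax gmin : ℝ}
    (hmax : IsGreatest (g '' (R : Set V)) gmax) (hmin : IsLeast (g '' (R : Set V)) gmin)
    {d : V → ℝ} (hd : ∀ i ∈ insert j (inNbrs G j), i ∉ F → g i = d i) :
    ∃ α ∈ validWeights F (betaTilde G F f hN) (gammaTilde G F f hN),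
      (gmax + gmin) / 2 = ∑ i ∈ Fᶜ, α i * d i := by
  set A := insert j (inNbrs G j) with hA
  have hjn : j ∉ inNbrs G j := by simp [inNbrs, hloop]
  have hcardA : A.card = inDeg G j + 1 := Finset.card_insert_of_notMem hjn
  have hcard : (A \ F).card + (inNbrs G j ∩ F).card = inDeg G j + 1 :=
    card_insert_inNbrs_sdiff hloop hj
  have hRc := hR.card_add
  have hRpos : 0 < R.card := by
    obtain ⟨r, hr, -⟩ := hmax.1
    exact Finset.card_pos.2 ⟨r, hr⟩
  have hφ : (inNbrs G j ∩ F).card ≤ f := (Finset.card_le_card Finset.inter_subset_right).trans hF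
  obtain ⟨m, hm⟩ : ∃ m, m + f = (A \ F).card := ⟨(A \ F).card - f, by omega⟩
  -- `m` is at least the number of surviving gradients, as `φ_j ≤ f`.
  have hm0 : 0 < m := by omega
  have hslack : slack G F f j = m := by
    have h1 : ((m : ℝ) + f) + ((inNbrs G j ∩ F).card : ℝ) = (inDeg G j : ℝ) + 1 := by
      exact_mod_cast hm ▸ hcard
    rw [slack]
    linarith
  obtain ⟨α, h0, hsupp, hsum, ⟨Q, hQA, hQc, hQ⟩, hval⟩ := hR.exists_weights hF hmax hmin hm hm0
  have hsub : A \ F ⊆ Fᶜ := fun i hi => Finset.mem_compl.2 (Finset.mem_sdiff.1 hi).2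
  have hjc : j ∈ Fᶜ := Finset.mem_compl.2 hj
  refine ⟨α, ⟨fun i _ => h0 i, ?_, ?_⟩, ?_⟩
  · rw [← Finset.sum_subset hsub fun i _ hi => hsupp i hi, hsum]
  · refine (Finset.inf'_le _ hjc).trans ?_
    rw [hslack]
    refine Nat.cast_le.2 (hQc ▸ Finset.card_le_card fun q hq => ?_)
    refine Finset.mem_filter.2 ⟨hsub (hQA hq), (min_le_left _ _).trans (le_trans ?_ (hQ q hq))⟩
    -- The weights `1 / (2 * m)` dominate the first term in the minimum defining `β̃`, and `m`, the
    -- slack of `j`, dominates `γ̃`.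
    have hle : (m : ℝ) ≤ Fᶜ.sup' hN (slack G F f) := hslack ▸ Finset.le_sup' _ hjc
    have hm0' : (0 : ℝ) < m := by exact_mod_cast hm0
    exact one_div_le_one_div_of_le (by linarith) (by linarith)
  · rw [← hval, ← Finset.sum_subset hsub fun i _ hi => by rw [hsupp i hi, zero_mul]]
    refine Finset.sum_congr rfl fun i hi => ?_
    rw [Finset.mem_sdiff] at hi
    rw [hd i hi.1 hi.2]

variable {G : Digraph V} {F : Finset V} {f : ℕ} {X : Set ℝ} {L : ℝ} {h : V → ℝ → ℝ}

/-- An update is a projected gradient step, with a valid gradient, from a trimmed mean `v`. -/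
theorem AlgorithmStep.exists_mean (hloop : ∀ i, ¬ G.Adj i i)
    (hG : EveryReducedGraphHasSource G f) (hF : F.card ≤ f) (hN : Fᶜ.Nonempty)
    {lam : ℝ} {x : V → ℝ} {j : V} {y : ℝ} (hj : j ∉ F)
    (hstep : AlgorithmStep G F f X h lam x j y) :
    ∃ v gt : ℝ, IsProjection X (v - lam * gt) y ∧
      (∃ α ∈ validWeights F (betaTilde G F f hN) (gammaTilde G F f hN),
        gt = ∑ i ∈ Fᶜ, α i * derivWithin (h i) X (x i)) ∧
      (∀ B ε, 0 ≤ ε → (∀ i, i ∉ F → x i ≤ B) → PulledBelow G F f x j (B - ε) →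
        v ≤ B - 1 / ((Fintype.card V : ℝ) + 1) * ε) ∧
      (∀ B ε, 0 ≤ ε → (∀ i, i ∉ F → -x i ≤ B) → PulledBelow G F f (fun i => -x i) j (B - ε) →
        -v ≤ B - 1 / ((Fintype.card V : ℝ) + 1) * ε) := by
  obtain ⟨w, g, hwg, R₁, R₂, hR₁, hR₂, gmax, gmin, hmax, hmin, hproj⟩ := hstep
  have hjn : j ∉ inNbrs G j := by simp [inNbrs, hloop]
  have hc : R₁.card + 2 * f = inDeg G j := hR₁.card_add
  have hc' : (inDeg G j : ℝ) + 1 - 2 * (f : ℝ) = (R₁.card : ℝ) + 1 := by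
    rw [← hc]; push_cast; ring
  rw [hc'] at hproj
  have hdeg : 0 < f → 2 * f < (inNbrs G j).card := fun hf =>
    hG.two_mul_lt_inDeg hloop hf (by omega)
  have hK : (R₁.card : ℝ) + 1 ≤ (Fintype.card V : ℝ) + 1 := by
    have : R₁.card ≤ Fintype.card V := Finset.card_le_univ _
    have : (R₁.card : ℝ) ≤ (Fintype.card V : ℝ) := by exact_mod_cast this
    linarith
  have hw : ∀ i ∈ insert j (inNbrs G j), i ∉ F → w i = x i := fun i hi hiF => (hwg i hi hiF).1
  have hwj : w j = x j := hw j (Finset.mem_insert_self _ _) hj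
  refine ⟨_, _, hproj, exists_validWeights_of_isTrimmed hloop hF hN hj hR₂ hmax hmin
    fun i hi hiF => (hwg i hi hiF).2, fun B ε hε hB hp => ?_, fun B ε hε hB hp => ?_⟩
  · refine hR₁.mean_le hF hjn hdeg hε hK (fun i hi hiF => (hw i hi hiF).trans_le (hB i hiF)) hj ?_
    refine hp.imp (fun h1 => hwj.trans_le h1) ?_
    rintro ⟨D, hD, hDc, hle⟩
    refine ⟨D, hD.trans Finset.sdiff_subset, hDc, fun i hi => ?_⟩
    have := Finset.mem_sdiff.1 (hD hi)
    exact (hw i (Finset.mem_insert_of_mem this.1) this.2).trans_le (hle i hi)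
  · rw [← mul_neg, ← Finset.sum_neg_distrib]
    refine hR₁.neg.mean_le hF hjn hdeg hε hK
      (fun i hi hiF => (congrArg Neg.neg (hw i hi hiF)).trans_le (hB i hiF)) hj ?_
    refine hp.imp (fun h1 => (congrArg Neg.neg hwj).trans_le h1) ?_
    rintro ⟨D, hD, hDc, hle⟩
    refine ⟨D, hD.trans Finset.sdiff_subset, hDc, fun i hi => ?_⟩
    have := Finset.mem_sdiff.1 (hD hi)
    exact (congrArg Neg.neg (hw i (Finset.mem_insert_of_mem this.1) this.2)).trans_le (hle i hi)

theorem abs_sum_derivWithin_le (hh : ∀ i, Admissible X L (h i)) {β γ : ℝ} {α x : V → ℝ}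
    (hα : α ∈ validWeights F β γ) (hx : ∀ i, i ∉ F → x i ∈ X) :
    |∑ i ∈ Fᶜ, α i * derivWithin (h i) X (x i)| ≤ L := by
  calc |∑ i ∈ Fᶜ, α i * derivWithin (h i) X (x i)|
      ≤ ∑ i ∈ Fᶜ, |α i * derivWithin (h i) X (x i)| := Finset.abs_sum_le_sum_abs _ _
    _ ≤ ∑ i ∈ Fᶜ, α i * L := Finset.sum_le_sum fun i hi => by
        rw [abs_mul, abs_of_nonneg (hα.1 i hi)]
        exact mul_le_mul_of_nonneg_left
          ((hh i).bounded_grad _ (hx i (Finset.mem_compl.1 hi))) (hα.1 i hi)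
    _ = L := by rw [← Finset.sum_mul, hα.2.1, one_mul]

theorem IsExecution.mem {lam : ℕ → ℝ} {x : ℕ → V → ℝ} (hx : IsExecution G F f X h lam x) (t : ℕ)
    (i : V) (hi : i ∉ F) : x t i ∈ X := by
  cases t with
  | zero => exact hx.1 i hi
  | succ t =>
    obtain ⟨w, g, -, R₁, R₂, -, -, gmax, gmin, -, -, hproj⟩ := hx.2 t i hi
    exact hproj.1

/-- `x` evolves by projected gradient steps, with gradients from the weights in `W`, that start
from values between the extreme estimates of the agents outside `F`. -/
def IsProjectedGradient (X : Set ℝ) (F : Finset V) (hN : Fᶜ.Nonempty) (h : V → ℝ → ℝ)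
    (W : Set (V → ℝ)) (lam : ℕ → ℝ) (x : ℕ → V → ℝ) : Prop :=
  (∀ t, ∀ i, i ∉ F → x t i ∈ X) ∧ ∀ t, ∀ j, j ∉ F → ∃ v ∈ X, v ≤ Fᶜ.sup' hN (x t) ∧
    Fᶜ.inf' hN (x t) ≤ v ∧ ∃ α ∈ W, IsProjection X
      (v - lam t * ∑ i ∈ Fᶜ, α i * derivWithin (h i) X (x t i)) (x (t + 1) j)

theorem mem_of_inf'_le_of_le_sup' (hX : X.OrdConnected) (hN : Fᶜ.Nonempty) {x : V → ℝ}
    (hx : ∀ i, i ∉ F → x i ∈ X) {v : ℝ} (h1 : v ≤ Fᶜ.sup' hN x) (h2 : Fᶜ.inf' hN x ≤ v) :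
    v ∈ X := by
  obtain ⟨i, hi, hie⟩ := Finset.exists_mem_eq_sup' hN x
  obtain ⟨k, hk, hke⟩ := Finset.exists_mem_eq_inf' hN x
  exact hX.out (hx k (Finset.mem_compl.1 hk)) (hx i (Finset.mem_compl.1 hi))
    ⟨hke ▸ h2, hie ▸ h1⟩

/-- A value that obeys the bounds of a trimmed mean lies between the extreme estimates. -/
theorem mean_mem_Icc (hN : Fᶜ.Nonempty) {x : V → ℝ} {j : V} (hj : j ∉ F) {v μ : ℝ}
    (hup : ∀ B ε, 0 ≤ ε → (∀ i, i ∉ F → x i ≤ B) → PulledBelow G F f x j (B - ε) →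
      v ≤ B - μ * ε)
    (hdown : ∀ B ε, 0 ≤ ε → (∀ i, i ∉ F → -x i ≤ B) →
      PulledBelow G F f (fun i => -x i) j (B - ε) → -v ≤ B - μ * ε) :
    v ≤ Fᶜ.sup' hN x ∧ Fᶜ.inf' hN x ≤ v := by
  have hle : ∀ i, i ∉ F → x i ≤ Fᶜ.sup' hN x := fun i hi =>
    Finset.le_sup' x (Finset.mem_compl.2 hi)
  have hge : ∀ i, i ∉ F → -x i ≤ -Fᶜ.inf' hN x := fun i hi =>
    neg_le_neg (Finset.inf'_le x (Finset.mem_compl.2 hi))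
  have h1 := hup _ 0 le_rfl hle (Or.inl (by simpa using hle j hj))
  have h2 := hdown _ 0 le_rfl hge (Or.inl (by simpa using hge j hj))
  rw [mul_zero, sub_zero] at h1 h2
  exact ⟨h1, neg_le_neg_iff.1 h2⟩

theorem IsExecution.isProjectedGradient (hloop : ∀ i, ¬ G.Adj i i)
    (hG : EveryReducedGraphHasSource G f) (hF : F.card ≤ f) (hN : Fᶜ.Nonempty)
    (hX : X.OrdConnected) {lam : ℕ → ℝ} {x : ℕ → V → ℝ} (hx : IsExecution G F f X h lam x) :
    IsProjectedGradient X F hN h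
      (validWeights F (betaTilde G F f hN) (gammaTilde G F f hN)) lam x := by
  refine ⟨hx.mem, fun t j hj => ?_⟩
  obtain ⟨v, gt, hproj, ⟨α, hα, rfl⟩, hup, hdown⟩ := (hx.2 t j hj).exists_mean hloop hG hF hN hj
  obtain ⟨h1, h2⟩ := mean_mem_Icc hN hj hup hdown
  exact ⟨v, mem_of_inf'_le_of_le_sup' hX hN (hx.mem t) h1 h2, h1, h2, α, hα, hproj⟩

/-- The gradient term is a perturbation of size at most `lam t * L` of a trimmed mean, and
projection does not spoil bounds that hold for the mean, which is in `X`. -/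
theorem IsExecution.tendsto_spread (hloop : ∀ i, ¬ G.Adj i i)
    (hG : EveryReducedGraphHasSource G f) (hF : F.card ≤ f) (hN : Fᶜ.Nonempty)
    (hX : X.OrdConnected) (hh : ∀ i, Admissible X L (h i)) (hL : 0 ≤ L) {lam : ℕ → ℝ}
    (hanti : Antitone lam) (hlam : ∀ t, 0 ≤ lam t) (hlim : Tendsto lam atTop (𝓝 0))
    {x : ℕ → V → ℝ} (hx : IsExecution G F f X h lam x) :
    Tendsto (fun t => Fᶜ.sup' hN (x t) - Fᶜ.inf' hN (x t)) atTop (𝓝 0) := by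
  have hcard : (0 : ℝ) ≤ Fintype.card V := Nat.cast_nonneg _
  have hmem : ∀ t j, j ∉ F → ∃ v gt : ℝ, v ∈ X ∧ |lam t * gt| ≤ lam t * L ∧
      IsProjection X (v - lam t * gt) (x (t + 1) j) ∧
      (∀ B ε, 0 ≤ ε → (∀ i, i ∉ F → x t i ≤ B) → PulledBelow G F f (x t) j (B - ε) →
        v ≤ B - 1 / ((Fintype.card V : ℝ) + 1) * ε) ∧
      (∀ B ε, 0 ≤ ε → (∀ i, i ∉ F → -x t i ≤ B) → PulledBelow G F f (fun i => -x t i) j (B - ε) →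
        -v ≤ B - 1 / ((Fintype.card V : ℝ) + 1) * ε) := by
    intro t j hj
    obtain ⟨v, gt, hproj, ⟨α, hα, rfl⟩, hup, hdown⟩ :=
      (hx.2 t j hj).exists_mean hloop hG hF hN hj
    obtain ⟨h1, h2⟩ := mean_mem_Icc hN hj hup hdown
    refine ⟨v, _, mem_of_inf'_le_of_le_sup' hX hN (hx.mem t) h1 h2, ?_, hproj,
      hup, hdown⟩
    rw [abs_mul, abs_of_nonneg (hlam t)]
    exact mul_le_mul_of_nonneg_left (abs_sum_derivWithin_le hh hα (hx.mem t)) (hlam t)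
  refine ByzantineOpt.tendsto_spread hG hF hN (μ := 1 / ((Fintype.card V : ℝ) + 1))
    (e := fun t => lam t * L) (by positivity) ?_ (fun t => mul_nonneg (hlam t) hL)
    (fun s t hst => mul_le_mul_of_nonneg_right (hanti hst) hL) (by simpa using hlim.mul_const L)
    (fun t j hj B ε hε hB hp => ?_) (fun t j hj B ε hε hB hp => ?_)
  · rw [div_le_one (by linarith)]; linarith
  · obtain ⟨v, gt, hv, hgt, hproj, hup, -⟩ := hmem t j hj
    have h1 := hup B ε hε hB hp
    have h2 := neg_le_of_abs_le hgt
    have h3 := mul_nonneg (hlam t) hL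
    exact (hproj.le_max hX hv).trans (max_le (by linarith) (by linarith))
  · obtain ⟨v, gt, hv, hgt, hproj, -, hdown⟩ := hmem t j hj
    have h1 := hdown B ε hε hB hp
    have h2 := le_of_abs_le hgt
    have h3 := mul_nonneg (hlam t) hL
    have h4 := hproj.min_le hX hv
    have h5 : v - lam t * L ≤ min (v - lam t * gt) v := le_min (by linarith) (by linarith)
    linarith

variable {β γ : ℝ} {lam : ℕ → ℝ} {x : ℕ → V → ℝ}

/-- The slope is bounded below at `b + ε / 4`, the descent level is `b + ε / 2` so that a spread
below `ε / 4` keeps all estimates past that point, and a further `ε / 4` absorbs late rises. This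
ends at `b + 3 * ε / 4`, below `y₁ + ε`. -/
theorem IsProjectedGradient.eventually_le (hh : ∀ i, Admissible X L (h i)) (hX : X.OrdConnected)
    (hN : Fᶜ.Nonempty)
    (hx : IsProjectedGradient X F hN h (validWeights F β γ) lam x) (hlam : ∀ t, 0 ≤ lam t)
    (hlim : Tendsto lam atTop (𝓝 0))
    (hsum : Tendsto (fun n => ∑ t ∈ Finset.range n, lam t) atTop atTop)
    (hspread : Tendsto (fun t => Fᶜ.sup' hN (x t) - Fᶜ.inf' hN (x t)) atTop (𝓝 0))
    (hYne : (optSet X F h β γ).Nonempty) {ε : ℝ} (hε : 0 < ε) :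
    ∀ᶠ t in atTop, ∀ i, i ∉ F → ∃ y ∈ optSet X F h β γ, x t i ≤ y + ε := by
  by_cases hbdd : BddAbove (optSet X F h β γ)
  swap
  · refine Eventually.of_forall fun t i _ => ?_
    obtain ⟨y, hy, hlt⟩ := not_bddAbove_iff.1 hbdd (x t i)
    exact ⟨y, hy, by linarith⟩
  set b := sSup (optSet X F h β γ)
  have hyb : ∀ y ∈ optSet X F h β γ, y ≤ b := fun y hy => le_csSup hbdd hy
  obtain ⟨y₁, hy₁, hby₁⟩ := exists_lt_of_lt_csSup hYne (show b - ε / 4 < b by linarith)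
  obtain ⟨y₀, hy₀⟩ := id hYne
  -- If this point is not in `X`, then no point of `X`, hence no estimate, lies beyond it.
  by_cases hx₀ : b + ε / 4 ∈ X
  swap
  · refine Eventually.of_forall fun t i hi => ⟨y₁, hy₁, ?_⟩
    by_contra! hlt
    have := hyb y₀ hy₀
    exact hx₀ (hX.out (optSet_subset hy₀) (hx.1 t i hi) ⟨by linarith, by linarith⟩)
  obtain ⟨δ, hδ, hgrad⟩ := exists_pos_le_sum_derivWithin hh hN hx₀
    fun y hy => (hyb y hy).trans_lt (by linarith : b < b + ε / 4)
  have hε4 : 0 < ε / 4 := by linarith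
  have hlimL : Tendsto (fun t => lam t * L) atTop (𝓝 0) := by simpa using hlim.mul_const L
  have hev := eventually_le_of_descent (M := fun t => Fᶜ.sup' hN (x t)) (c := b + ε / 2)
    (η := ε / 4) hδ hlam hsum hε4.le ?_ ?_
  · filter_upwards [hev] with t ht i hi
    exact ⟨y₁, hy₁, (Finset.le_sup' (x t) (Finset.mem_compl.2 hi)).trans (by linarith)⟩
  · filter_upwards [hspread.eventually (gt_mem_nhds hε4)] with t ht hM
    refine Finset.sup'_le hN _ fun j hj => ?_
    obtain ⟨v, -, hv1, -, α, hα, hproj⟩ := hx.2 t j (Finset.mem_compl.1 hj)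
    have hg : δ ≤ ∑ i ∈ Fᶜ, α i * derivWithin (h i) X (x t i) := by
      refine (hgrad α hα).trans (Finset.sum_le_sum fun i hi => ?_)
      refine mul_le_mul_of_nonneg_left ?_ (hα.1 i hi)
      have := Finset.inf'_le (x t) hi
      exact (hh i).derivWithin_mono hx₀ (hx.1 t i (Finset.mem_compl.1 hi)) (by linarith)
    have h1 := mul_le_mul_of_nonneg_left hg (hlam t)
    have h2 := hyb y₀ hy₀
    -- Comparing with `y₀ ∈ X`, which lies below the descent level, lets the projection pull upwards
    -- at most to that level.
    exact (hproj.le_max hX (optSet_subset hy₀)).trans (max_le_max (by linarith) (by linarith))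
  · filter_upwards [hlimL.eventually (gt_mem_nhds hε4)] with t ht hM
    refine Finset.sup'_le hN _ fun j hj => ?_
    obtain ⟨v, hvX, hv1, -, α, hα, hproj⟩ := hx.2 t j (Finset.mem_compl.1 hj)
    have h1 := mul_le_mul_of_nonneg_left
      (neg_le_of_abs_le (abs_sum_derivWithin_le hh hα (hx.1 t))) (hlam t)
    exact (hproj.le_max hX hvX).trans (max_le (by linarith) (by linarith))

theorem IsProjectedGradient.eventually_ge (hh : ∀ i, Admissible X L (h i)) (hX : X.OrdConnected)
    (hN : Fᶜ.Nonempty)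
    (hx : IsProjectedGradient X F hN h (validWeights F β γ) lam x) (hlam : ∀ t, 0 ≤ lam t)
    (hlim : Tendsto lam atTop (𝓝 0))
    (hsum : Tendsto (fun n => ∑ t ∈ Finset.range n, lam t) atTop atTop)
    (hspread : Tendsto (fun t => Fᶜ.sup' hN (x t) - Fᶜ.inf' hN (x t)) atTop (𝓝 0))
    (hYne : (optSet X F h β γ).Nonempty) {ε : ℝ} (hε : 0 < ε) :
    ∀ᶠ t in atTop, ∀ i, i ∉ F → ∃ y ∈ optSet X F h β γ, y - ε ≤ x t i := by
  by_cases hbdd : BddBelow (optSet X F h β γ)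
  swap
  · refine Eventually.of_forall fun t i _ => ?_
    obtain ⟨y, hy, hlt⟩ := not_bddBelow_iff.1 hbdd (x t i)
    exact ⟨y, hy, by linarith⟩
  set a := sInf (optSet X F h β γ)
  have hya : ∀ y ∈ optSet X F h β γ, a ≤ y := fun y hy => csInf_le hbdd hy
  obtain ⟨y₁, hy₁, hay₁⟩ := exists_lt_of_csInf_lt hYne (show a < a + ε / 4 by linarith)
  obtain ⟨y₀, hy₀⟩ := id hYne
  by_cases hx₀ : a - ε / 4 ∈ X
  swap
  · refine Eventually.of_forall fun t i hi => ⟨y₁, hy₁, ?_⟩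
    by_contra! hlt
    have := hya y₀ hy₀
    exact hx₀ (hX.out (hx.1 t i hi) (optSet_subset hy₀) ⟨by linarith, by linarith⟩)
  obtain ⟨δ, hδ, hgrad⟩ := exists_pos_sum_derivWithin_le hh hN hx₀
    fun y hy => (by linarith : a - ε / 4 < a).trans_le (hya y hy)
  have hε4 : 0 < ε / 4 := by linarith
  have hlimL : Tendsto (fun t => lam t * L) atTop (𝓝 0) := by simpa using hlim.mul_const L
  have hev := eventually_le_of_descent (M := fun t => -Fᶜ.inf' hN (x t)) (c := -a + ε / 2)
    (η := ε / 4) hδ hlam hsum hε4.le ?_ ?_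
  · filter_upwards [hev] with t ht i hi
    exact ⟨y₁, hy₁, le_trans (by linarith) (Finset.inf'_le (x t) (Finset.mem_compl.2 hi))⟩
  · filter_upwards [hspread.eventually (gt_mem_nhds hε4)] with t ht hM
    refine neg_le.1 (Finset.le_inf' hN _ fun j hj => ?_)
    obtain ⟨v, -, -, hv1, α, hα, hproj⟩ := hx.2 t j (Finset.mem_compl.1 hj)
    have hg : ∑ i ∈ Fᶜ, α i * derivWithin (h i) X (x t i) ≤ -δ := by
      refine (Finset.sum_le_sum fun i hi => ?_).trans (hgrad α hα)
      refine mul_le_mul_of_nonneg_left ?_ (hα.1 i hi)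
      have := Finset.le_sup' (x t) hi
      exact (hh i).derivWithin_mono (hx.1 t i (Finset.mem_compl.1 hi)) hx₀ (by linarith)
    have h1 := mul_le_mul_of_nonneg_left hg (hlam t)
    have h2 := hya y₀ hy₀
    rw [← min_neg_neg]
    exact (min_le_min (by linarith) (by linarith)).trans (hproj.min_le hX (optSet_subset hy₀))
  · filter_upwards [hlimL.eventually (gt_mem_nhds hε4)] with t ht hM
    refine neg_le.1 (Finset.le_inf' hN _ fun j hj => ?_)
    obtain ⟨v, hvX, -, hv1, α, hα, hproj⟩ := hx.2 t j (Finset.mem_compl.1 hj)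
    have h1 := mul_le_mul_of_nonneg_left
      (le_of_abs_le (abs_sum_derivWithin_le hh hα (hx.1 t))) (hlam t)
    exact (le_min (by linarith) (by linarith)).trans (hproj.min_le hX hvX)

end Algorithm

/-! ### Distance to the interval and conclusion -/

theorem infDist_le_of_between {Y : Set ℝ} (hY : Y.OrdConnected) {x y₁ y₂ ε : ℝ} (hε : 0 ≤ ε)
    (hy₁ : y₁ ∈ Y) (hy₂ : y₂ ∈ Y) (h1 : y₁ - ε ≤ x) (h2 : x ≤ y₂ + ε) :
    Metric.infDist x Y ≤ ε := by
  rcases le_total y₂ x with h | h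
  · refine (Metric.infDist_le_dist_of_mem hy₂).trans ?_
    rw [Real.dist_eq, abs_of_nonneg (by linarith)]; linarith
  rcases le_total x y₁ with h' | h'
  · refine (Metric.infDist_le_dist_of_mem hy₁).trans ?_
    rw [Real.dist_eq, abs_of_nonpos (by linarith)]; linarith
  · rw [Metric.infDist_zero_of_mem (hY.out hy₁ hy₂ ⟨h', h⟩)]
    exact hε

theorem IsStepsize.tendsto_zero {lam : ℕ → ℝ} (hlam : IsStepsize lam) :
    Tendsto lam atTop (𝓝 0) := by
  have h1 := hlam.sum_sq_finite.tendsto_atTop_zero.sqrt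
  simp only [Real.sqrt_sq_eq_abs, Real.sqrt_zero] at h1
  exact (tendsto_zero_iff_abs_tendsto_zero lam).2 h1

end ByzantineOpt

/-- For every choice of a non-faulty agent `j t` whose estimate has maximal distance to
`Y = Y(β̃, γ̃)` among the non-faulty agents, the distance of `z[t] = x t (j t)` to `Y` tends to
`0`; also `Y` is nonempty, so that this distance is a genuine one. -/
theorem mainTheorem2 {V : Type*} [Fintype V] [DecidableEq V]
    (G : Digraph V) (hloop : ∀ i, ¬ G.Adj i i)
    (f : ℕ) (hG : ByzantineOpt.EveryReducedGraphHasSource G f)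
    (F : Finset V) (hF : F.card ≤ f)
    (X : Set ℝ) (hXne : X.Nonempty) (hXclosed : IsClosed X) (hXconvex : Convex ℝ X)
    (L : ℝ) (h : V → ℝ → ℝ) (hh : ∀ i, ByzantineOpt.Admissible X L (h i))
    (lam : ℕ → ℝ) (hlam : ByzantineOpt.IsStepsize lam)
    (x : ℕ → V → ℝ) (hx : ByzantineOpt.IsExecution G F f X h lam x)
    (Y : Set ℝ)
    (hY : Y = ByzantineOpt.optSet X F h
      (ByzantineOpt.betaTilde G F f (hG.nonempty hF))
      (ByzantineOpt.gammaTilde G F f (hG.nonempty hF)))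
    (j : ℕ → V) (hj : ∀ t, j t ∉ F)
    (hjmax : ∀ t, ∀ i, i ∉ F → Metric.infDist (x t i) Y ≤ Metric.infDist (x t (j t)) Y) :
    Y.Nonempty ∧
    Filter.Tendsto (fun t => Metric.infDist (x t (j t)) Y) Filter.atTop (nhds 0) := by
  have hN := hG.nonempty hF
  have hX := hXconvex.ordConnected
  have hβ : ByzantineOpt.betaTilde G F f hN ≤ 1 / (Fᶜ.card : ℝ) := min_le_right _ _
  have hYne : Y.Nonempty := hY ▸ ByzantineOpt.optSet_nonempty hh hN hβ
    (ByzantineOpt.gammaTilde_le_card hloop F f hN)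
  have hYo : Y.OrdConnected := hY ▸ ByzantineOpt.optSet_ordConnected hh hX hN hβ
  obtain ⟨p, hp⟩ := hXne
  have hL : 0 ≤ L := (abs_nonneg _).trans ((hh (j 0)).bounded_grad p hp)
  have hlim := hlam.tendsto_zero
  -- Stepsizes that decrease to 0 are nonnegative.
  have hlam0 : ∀ t, 0 ≤ lam t := fun t => hlam.antitone.le_of_tendsto hlim t
  have hpg := hx.isProjectedGradient hloop hG hF hN hX
  have hspread := hx.tendsto_spread hloop hG hF hN hX hh hL hlam.antitone hlam0 hlim
  refine ⟨hYne, tendsto_order.2 ⟨fun a ha => Filter.Eventually.of_forall fun t =>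
    ha.trans_le Metric.infDist_nonneg, fun a ha => ?_⟩⟩
  rw [hY] at hYne hYo ⊢
  filter_upwards [ByzantineOpt.IsProjectedGradient.eventually_le hh hX hN hpg hlam0 hlim hlam.sum_infinite hspread hYne
      (half_pos ha),
    ByzantineOpt.IsProjectedGradient.eventually_ge hh hX hN hpg hlam0 hlim hlam.sum_infinite hspread hYne (half_pos ha)]
    with t hle hge
  obtain ⟨y₂, hy₂, h2⟩ := hle (j t) (hj t)
  obtain ⟨y₁, hy₁, h1⟩ := hge (j t) (hj t)
  exact (ByzantineOpt.infDist_le_of_between hYo (half_pos ha).le hy₁ hy₂ h1 h2).trans_lt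
    (half_lt_self ha)
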